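/- Let $N \ge 2$, let $B_1^N \subset \mathbb{R}^N$ be the open unit ball, and let $C_0^\infty(B_1^N)$ be the space of real-valued smooth functions with compact support in $B_1^N$. Let $X_N$ be the set of $u \in C_0^\infty(B_1^N)$ with spherical average zero, i.e. $\int_{\mathbb{S}^{N-1}} u(r\omega)\,dS_\omega = 0$ for all $r \ge 0$. Then for every $u \in X_N$ the function $|u|^2/|x|^2$ is integrable on $B_1^N$ and $$\frac{N^2}{4} \int_{B_1^N} \frac{|u|^2}{|x|^2}\,dx \le \int_{B_1^N} |\nabla u|^2\,dx .$$ The constant $\frac{N^2}{4}$ is best possible: if $C \in \mathbb{R}$ satisfies $C \int_{B_1^N} \frac{|u|^2}{|x|^2}\,dx \le \int_{B_1^N} |\nabla u|^2\,dx$ for all $u \in X_N$, then $C \le \frac{N^2}{4}$. It is not attained: let $H_0^1(B_1^N)$ be the completion of $C_0^\infty(B_1^N)$ with respect to $\|\nabla(\cdot)\|_{L^2(B_1^N)}$, realized as functions in $L^2(B_1^N)$ with weak gradient; there is no $u \in H_0^1(B_1^N) \setminus \{0\}$ with $\int_{\mathbb{S}^{N-1}} u(r\omega)\,dS_\omega =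 0$ for almost every $r \in (0,1)$ and $$\frac{N^2}{4} \int_{B_1^N} \frac{|u|^2}{|x|^2}\,dx = \int_{B_1^N} |\nabla u|^2\,dx .$$ Moreover, in dimension $N = 2$, for every $u \in X_2$ the function $|u|^2/\bigl(|x|^2 (\log \frac{e}{|x|})^2\bigr)$ is integrable on $B_1^2$ and $$\frac{5}{4} \int_{B_1^2} \frac{|u|^2}{|x|^2 \left(\log \frac{e}{|x|}\right)^2}\,dx \le \int_{B_1^2} |\nabla u|^2\,dx .$$ -/

import Mathlib

open MeasureTheory Metric Filter Topology
open scoped ContDiff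

/-- `C_0^∞(B_1^N)`: real-valued smooth functions with compact support contained in the open unit
ball of `ℝ^N`. -/
structure IsTestFunction {N : ℕ} (u : EuclideanSpace ℝ (Fin N) → ℝ) : Prop where
  smooth : ContDiff ℝ ∞ u
  hasCompactSupport : HasCompactSupport u
  tsupport_subset : tsupport u ⊆ ball 0 1

/-- `∫_{S^{N-1}} u(r θ) dS_θ`, with respect to the surface measure of the unit sphere. -/
noncomputable def sphereIntegral {N : ℕ} (u : EuclideanSpace ℝ (Fin N) → ℝ) (r : ℝ) : ℝ :=
  ∫ θ : sphere (0 : EuclideanSpace ℝ (Fin N)) 1, u (r • (θ : EuclideanSpace ℝ (Fin N)))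
    ∂(volume : Measure (EuclideanSpace ℝ (Fin N))).toSphere

/-- `u` belongs to `H_0^1(B_1^N)` and `G` is its weak gradient: the pair `(u, G)` is the limit in
`L^2(B_1^N) × L^2(B_1^N; ℝ^N)` of pairs `(φ, ∇φ)` with `φ ∈ C_0^∞(B_1^N)`.
By the Poincaré inequality this closure is the completion of `C_0^∞(B_1^N)` in `‖∇ ·‖_2`. -/
structure IsH10WithGradient {N : ℕ} (u : EuclideanSpace ℝ (Fin N) → ℝ)
    (G : EuclideanSpace ℝ (Fin N) → EuclideanSpace ℝ (Fin N)) : Prop where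
  memLp : MemLp u 2 (volume.restrict (ball 0 1))
  memLp_grad : MemLp G 2 (volume.restrict (ball 0 1))
  exists_approx : ∃ φ : ℕ → EuclideanSpace ℝ (Fin N) → ℝ,
    (∀ n, IsTestFunction (φ n)) ∧
    Tendsto (fun n => eLpNorm (fun x => φ n x - u x) 2 (volume.restrict (ball 0 1)))
      atTop (𝓝 0) ∧
    Tendsto (fun n => eLpNorm (fun x => gradient (φ n) x - G x) 2 (volume.restrict (ball 0 1)))
      atTop (𝓝 0)

/-!
Write `x = r ω` in polar coordinates. The gradient splits into its radial part `∂_r u` and a part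
tangent to the sphere, and each part is bounded below on its own.

* Tangential part. On the unit sphere of `ℝ^N` a function of mean zero satisfies
  `(N - 1) ∫ g² ≤ ∫ |∇_ω g|²` (`sphere_poincare`). This follows from the Gaussian Poincaré inequality
  `Var f ≤ E |∇f|²` (`variance_stdGaussian_le`), applied to the homogeneous extension
  `f(x) = |x| g(x / |x|)`: in polar coordinates it reads
  `E |x|² ∫ g² ≤ ∫ |∇_ω g|² + ∫ g²` up to a common factor, and `E |x|² = N`. As `f` is unbounded and
  not smooth at the origin, it is cut off on a logarithmic scale (`separated`). The Gaussian inequality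
  itself is obtained by differentiating `t ↦ E [f(X) f(X cos t + Y sin t)]` for independent standard
  Gaussian `X`, `Y`.
* Radial part. With `L = log (e / r)`, every `f` with `f 1 = 0` satisfies
  `∫ ((N - 2)² / 4 + 1 / (4 L²)) f² r^(N - 3) dr ≤ ∫ f'² r^(N - 1) dr`
  on `(0, 1)` (`lintegral_hardy_log_le`), by completing a square.

Since `(N - 2)² / 4 + (N - 1) = N² / 4`, the sum of the two bounds is the Hardy inequality with the
extra term `1 / 4 ∫ u² / (|x|² L²)` (`integral_hardy_le`). For a test function which does not have mean
zero, the tangential bound holds for its deviation from the spherical means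
(`lintegral_hardy_add_le`). In this form the inequality passes to the limit in `H_0^1`, although the
approximating test functions need not have mean zero: by Fatou's lemma, along a subsequence for
which the functions and their spherical means converge almost everywhere.

The extra term excludes equality in the energy space. In dimension two, where `N² / 4 = 1` and
`L ≥ 1`, it turns the constant `1` into `5 / 4` for the logarithmic weight. The constant `N² / 4` is
seen to be optimal by testing with `x_i |x|^(-N / 2) η(ε log |x|)`, summed over `i`: in the variable
`log |x|` the quotient is `N² / 4 + ε² ∫ η'² / ∫ η²` (`le_of_forall_hardy`).
-/

/-! ### The Gaussian Poincaré inequality -/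

open ProbabilityTheory in
/-- The standard Gaussian measure has the expected density with respect to Lebesgue measure, up to
the value of the normalizing constant, which plays no role. Both sides have the same
characteristic function. -/
theorem stdGaussian_eq_withDensity {E : Type*} [NormedAddCommGroup E] [InnerProductSpace ℝ E]
    [FiniteDimensional ℝ E] [MeasurableSpace E] [BorelSpace E] :
    ∃ c : ℝ, 0 < c ∧ stdGaussian E
      = volume.withDensity (fun x : E => ENNReal.ofReal (c * Real.exp (-(1 / 2) * ‖x‖ ^ 2))) := by
  set d : ℂ := (Real.pi / (1 / 2 : ℂ)) ^ (Module.finrank ℝ E / 2 : ℂ) with hd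
  have hre : (0 : ℝ) < ((1 / 2 : ℂ)).re := by norm_num
  set c : ℝ := ((Real.pi / (1 / 2)) ^ (Module.finrank ℝ E / 2 : ℝ))⁻¹ with hc
  have hc0 : 0 < c := by positivity
  have hcd : (c : ℂ) = d⁻¹ := by
    rw [hc, hd, Complex.ofReal_inv, Complex.ofReal_cpow (by positivity)]
    push_cast
    rfl
  have hd0 : d ≠ 0 := by
    intro h
    rw [h, inv_zero, Complex.ofReal_eq_zero] at hcd
    exact hc0.ne' hcd
  refine ⟨c, hc0, ?_⟩
  have hmeas : Measurable fun x : E => ENNReal.ofReal (c * Real.exp (-(1 / 2) * ‖x‖ ^ 2)) := by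
    fun_prop
  have hint : Integrable fun x : E => c * Real.exp (-(1 / 2) * ‖x‖ ^ 2) := by
    have h := (GaussianFourier.integrable_cexp_neg_mul_sq_norm_add hre 0 (0 : E)).re
    refine (h.congr (Eventually.of_forall fun x => ?_)).const_mul c
    have : (-(1 / 2 : ℂ) * (‖x‖ : ℂ) ^ 2 + 0 * (inner ℝ (0 : E) x : ℝ))
        = ((-(1 / 2) * ‖x‖ ^ 2 : ℝ) : ℂ) := by push_cast; simp
    simp only [this]
    rw [← Complex.ofReal_exp]
    exact Complex.ofReal_re _
  have := isFiniteMeasure_withDensity_ofReal hint.hasFiniteIntegral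
  refine Measure.ext_of_charFun ?_
  ext t
  rw [charFun_stdGaussian, charFun_apply, integral_withDensity_eq_integral_toReal_smul hmeas
    (Eventually.of_forall fun x => ENNReal.ofReal_lt_top)]
  have key := GaussianFourier.integral_cexp_neg_mul_sq_norm_add hre Complex.I t
  have : (fun x : E => (ENNReal.ofReal (c * Real.exp (-(1 / 2) * ‖x‖ ^ 2))).toReal •
      Complex.exp ((inner ℝ x t : ℝ) * Complex.I))
      = fun x => (c : ℂ) * Complex.exp (-(1 / 2 : ℂ) * (‖x‖ : ℂ) ^ 2
        + Complex.I * (inner ℝ t x : ℝ)) := by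
    ext x
    rw [ENNReal.toReal_ofReal (by positivity), Complex.real_smul, Complex.exp_add,
      real_inner_comm]
    push_cast
    ring_nf
  rw [this, integral_const_mul, key, ← hd, hcd, ← mul_assoc, inv_mul_cancel₀ hd0, one_mul]
  congr 1
  rw [Complex.I_sq]
  ring

section Gaussian

open ProbabilityTheory

variable {E : Type*} [NormedAddCommGroup E] [InnerProductSpace ℝ E]
  [FiniteDimensional ℝ E] [MeasurableSpace E] [BorelSpace E]

/-- Gaussian integration by parts: `E [g(Y) ⟨v, Y⟩] = E [∂_v g(Y)]`. -/
theorem integral_mul_inner_stdGaussian {g : E → ℝ} (hg : ContDiff ℝ 1 g) {C : ℝ}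
    (hC : ∀ x, |g x| ≤ C) (hC' : ∀ x, ‖fderiv ℝ g x‖ ≤ C) (v : E) :
    ∫ y, g y * inner ℝ v y ∂stdGaussian E = ∫ y, fderiv ℝ g y v ∂stdGaussian E := by
  obtain ⟨c, hc, hμ⟩ := stdGaussian_eq_withDensity (E := E)
  have hmeas : Measurable fun x : E => ENNReal.ofReal (c * Real.exp (-(1 / 2) * ‖x‖ ^ 2)) := by
    fun_prop
  have hlt : ∀ᵐ x : E, ENNReal.ofReal (c * Real.exp (-(1 / 2) * ‖x‖ ^ 2)) < ⊤ :=
    Eventually.of_forall fun x => ENNReal.ofReal_lt_top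
  have hint : ∀ {h : E → ℝ}, Integrable h (stdGaussian E) →
      Integrable fun x => c * Real.exp (-(1 / 2) * ‖x‖ ^ 2) * h x := by
    intro h hh
    rw [hμ, integrable_withDensity_iff_integrable_smul' hmeas hlt] at hh
    refine hh.congr (Eventually.of_forall fun x => ?_)
    simp only [smul_eq_mul]
    rw [ENNReal.toReal_ofReal (by positivity)]
  have hval : ∀ h : E → ℝ, ∫ x, h x ∂stdGaussian E
      = ∫ x, c * Real.exp (-(1 / 2) * ‖x‖ ^ 2) * h x := by
    intro h
    rw [hμ, integral_withDensity_eq_integral_toReal_smul hmeas hlt]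
    congr 1; ext x
    rw [ENNReal.toReal_ofReal (by positivity), smul_eq_mul]
  have hgc : Continuous g := hg.continuous
  have hg'c : Continuous (fderiv ℝ g) := hg.continuous_fderiv one_ne_zero
  have i1 : Integrable g (stdGaussian E) :=
    Integrable.of_bound hgc.aestronglyMeasurable C (Eventually.of_forall hC)
  have i2 : Integrable (fun y => fderiv ℝ g y v) (stdGaussian E) := by
    refine Integrable.of_bound (by fun_prop) (C * ‖v‖) (Eventually.of_forall fun y => ?_)
    exact ((fderiv ℝ g y).le_opNorm v).trans (by gcongr; exact hC' y)
  have i3 : Integrable (fun y => g y * inner ℝ v y) (stdGaussian E) := by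
    refine Integrable.bdd_mul (c := C) ?_ hgc.aestronglyMeasurable (Eventually.of_forall hC)
    exact (innerSL ℝ v).integrable_comp IsGaussian.integrable_id
  have hw : ∀ x : E, HasFDerivAt (fun x : E => c * Real.exp (-(1 / 2) * ‖x‖ ^ 2))
      (-(c * Real.exp (-(1 / 2) * ‖x‖ ^ 2)) • innerSL ℝ x) x := by
    intro x
    have h1 := (hasStrictFDerivAt_norm_sq x).hasFDerivAt
    convert! (((h1.const_mul (-(1 / 2) : ℝ)).exp).const_mul c) using 1
    ext y
    simp
    ring
  have hf : ∀ x : E, fderiv ℝ (fun x : E => c * Real.exp (-(1 / 2) * ‖x‖ ^ 2)) x v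
      = -(c * Real.exp (-(1 / 2) * ‖x‖ ^ 2)) * inner ℝ v x := by
    intro x
    rw [(hw x).fderiv]
    simp [real_inner_comm]
  have key := integral_mul_fderiv_eq_neg_fderiv_mul_of_integrable (μ := (volume : Measure E))
    (f := fun x : E => c * Real.exp (-(1 / 2) * ‖x‖ ^ 2)) (g := g) (v := v) ?_ (hint i2) (hint i1)
    (fun x _ => (hw x).differentiableAt) (fun x _ => hg.differentiable one_ne_zero x)
  · rw [hval, hval, key, ← integral_neg]
    congr 1; ext x
    rw [hf]; ring
  · refine ((hint i3).neg).congr (Eventually.of_forall fun x => ?_)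
    simp only [hf, Pi.neg_apply]
    ring

theorem integral_comp_rotation_stdGaussian (θ : ℝ) {H : E × E → ℝ} (hH : Continuous H) :
    ∫ z, H (ContinuousLinearMap.rotation θ z) ∂(stdGaussian E).prod (stdGaussian E)
      = ∫ z, H z ∂(stdGaussian E).prod (stdGaussian E) := by
  rw [← integral_map (φ := ContinuousLinearMap.rotation θ) (by fun_prop)
    hH.aestronglyMeasurable, IsGaussian.map_rotation_eq_self]
  simp

/-- The derivative of `t ↦ E[f(X) f(X cos t + Y sin t)]` for independent standard Gaussian
vectors `X`, `Y`. After a rotation of `(X, Y)` the derivative falls on one factor and Gaussian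
integration by parts moves it to the other one. -/
theorem hasDerivAt_integral_mul_comp_rotation {f : E → ℝ} (hf : ContDiff ℝ 1 f) {C : ℝ}
    (hC : ∀ x, |f x| ≤ C) (hC' : ∀ x, ‖fderiv ℝ f x‖ ≤ C) (t : ℝ) :
    HasDerivAt (fun t => ∫ z : E × E, f z.1 * f (Real.cos t • z.1 + Real.sin t • z.2)
        ∂(stdGaussian E).prod (stdGaussian E))
      (-Real.sin t * ∫ z : E × E, inner ℝ (gradient f (Real.cos t • z.1 - Real.sin t • z.2))
        (gradient f z.1) ∂(stdGaussian E).prod (stdGaussian E)) t := by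
  have hC0 : 0 ≤ C := (abs_nonneg _).trans (hC 0)
  have hfc : Continuous f := hf.continuous
  have hf'c : Continuous (fderiv ℝ f) := hf.continuous_fderiv one_ne_zero
  have hgc : Continuous (gradient f) := by
    unfold gradient
    exact (InnerProductSpace.toDual ℝ E).symm.continuous.comp hf'c
  have hid : Integrable (fun x : E => ‖x‖) (stdGaussian E) := IsGaussian.integrable_id.norm
  have hbound : Integrable (fun z : E × E => C * (C * (‖z.1‖ + ‖z.2‖)))
      ((stdGaussian E).prod (stdGaussian E)) :=
    (((hid.comp_fst _).add (hid.comp_snd _)).const_mul C).const_mul C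
  have h1 := (hasDerivAt_integral_of_dominated_loc_of_deriv_le
    (μ := (stdGaussian E).prod (stdGaussian E)) (x₀ := t) (s := Set.univ)
    (F := fun t z => f z.1 * f (Real.cos t • z.1 + Real.sin t • z.2))
    (F' := fun t z => f z.1 * fderiv ℝ f (Real.cos t • z.1 + Real.sin t • z.2)
      (-Real.sin t • z.1 + Real.cos t • z.2))
    (bound := fun z => C * (C * (‖z.1‖ + ‖z.2‖))) univ_mem
    (Eventually.of_forall fun t => (by fun_prop : Continuous _).aestronglyMeasurable)
    (Integrable.of_bound (by fun_prop : Continuous _).aestronglyMeasurable (C * C)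
      (Eventually.of_forall fun z => ?_))
    (by fun_prop : Continuous _).aestronglyMeasurable
    (Eventually.of_forall fun z t _ => ?_) hbound (Eventually.of_forall fun z t _ => ?_)).2
  · convert! h1 using 1
    -- Rotate so that `X cos t + Y sin t` becomes `X` and `-X sin t + Y cos t` becomes `Y`.
    have h2 := integral_comp_rotation_stdGaussian (E := E) t
      (H := fun z => f (Real.cos t • z.1 - Real.sin t • z.2) * fderiv ℝ f z.1 z.2) (by fun_prop)
    have h3 : ∀ z : E × E, f (Real.cos t • (ContinuousLinearMap.rotation t z).1
        - Real.sin t • (ContinuousLinearMap.rotation t z).2) = f z.1 := by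
      intro z
      congr 1
      rw [ContinuousLinearMap.rotation_apply]
      have := Real.cos_sq_add_sin_sq t
      calc _ = (Real.cos t ^ 2 + Real.sin t ^ 2) • z.1 := by module
        _ = z.1 := by rw [this, one_smul]
    simp only [h3] at h2
    simp only [ContinuousLinearMap.rotation_apply] at h2
    rw [h2, ← integral_const_mul, integral_prod, integral_prod]
    · -- For fixed `X = x`, integrate by parts in `Y` in the direction `∇ f(x)`.
      congr 1; ext x
      have h4 := integral_mul_inner_stdGaussian
        (g := fun y : E => f (Real.cos t • x - Real.sin t • y)) (by fun_prop) (C := C)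
        (fun y => hC _) (fun y => ?_) (gradient f x)
      · have h5 : ∀ y : E, inner ℝ (gradient f x) y = fderiv ℝ f x y := by
          intro y; simp [gradient]
        have h6 : ∀ y : E, fderiv ℝ (fun y : E => f (Real.cos t • x - Real.sin t • y)) y
            (gradient f x)
            = -Real.sin t * inner ℝ (gradient f (Real.cos t • x - Real.sin t • y))
              (gradient f x) := by
          intro y
          have hd : HasFDerivAt (fun y : E => Real.cos t • x - Real.sin t • y)
              (-(Real.sin t • ContinuousLinearMap.id ℝ E)) y :=
            ((hasFDerivAt_id y).const_smul (Real.sin t)).const_sub _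
          have := ((hf.differentiable one_ne_zero _).hasFDerivAt.comp y hd).fderiv
          rw [Function.comp_def] at this
          rw [this]
          simp [gradient]
        simp only [h5, h6] at h4
        exact h4.symm
      · have hd : HasFDerivAt (fun y : E => Real.cos t • x - Real.sin t • y)
            (-(Real.sin t • ContinuousLinearMap.id ℝ E)) y :=
          ((hasFDerivAt_id y).const_smul (Real.sin t)).const_sub _
        have := ((hf.differentiable one_ne_zero _).hasFDerivAt.comp y hd).fderiv
        rw [Function.comp_def] at this
        rw [this]
        refine (ContinuousLinearMap.opNorm_comp_le _ _).trans ?_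
        have h7 : ‖-(Real.sin t • ContinuousLinearMap.id ℝ E)‖ ≤ 1 := by
          rw [norm_neg, norm_smul]
          exact mul_le_one₀ (Real.abs_sin_le_one t) (norm_nonneg _)
            ContinuousLinearMap.norm_id_le
        calc _ ≤ C * 1 := by gcongr; exact hC' _
          _ = C := mul_one C
    · refine hbound.mono' (by fun_prop : Continuous _).aestronglyMeasurable
        (Eventually.of_forall fun z => ?_)
      rw [norm_mul]
      gcongr
      · exact hC _
      · refine ((fderiv ℝ f z.1).le_opNorm _).trans ?_
        gcongr
        · exact hC' _
        · exact le_add_of_nonneg_left (norm_nonneg _)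
    · refine Integrable.of_bound (by fun_prop : Continuous _).aestronglyMeasurable (C * C)
        (Eventually.of_forall fun z => ?_)
      rw [norm_mul, norm_neg]
      calc _ ≤ 1 * (C * C) := by
            gcongr
            · exact Real.abs_sin_le_one t
            · refine (norm_inner_le_norm _ _).trans ?_
              gcongr <;> simp only [gradient, LinearIsometryEquiv.norm_map] <;> exact hC' _
        _ = C * C := one_mul _
  · rw [norm_mul]
    gcongr <;> exact hC _
  · rw [norm_mul]
    gcongr
    · exact hC _
    · refine ((fderiv ℝ f _).le_opNorm _).trans ?_
      gcongr
      · exact hC' _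
      · refine (norm_add_le _ _).trans ?_
        rw [norm_smul, norm_smul, norm_neg]
        gcongr
        · exact mul_le_of_le_one_left (norm_nonneg _) (Real.abs_sin_le_one t)
        · exact mul_le_of_le_one_left (norm_nonneg _) (Real.abs_cos_le_one t)
  · have hd : HasDerivAt (fun t : ℝ => Real.cos t • z.1 + Real.sin t • z.2)
        (-Real.sin t • z.1 + Real.cos t • z.2) t :=
      ((Real.hasDerivAt_cos t).smul_const _).add ((Real.hasDerivAt_sin t).smul_const _)
    exact ((hf.differentiable one_ne_zero _).hasFDerivAt.comp_hasDerivAt t hd).const_mul _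

/-- The Gaussian Poincaré inequality. Its two sides are compared along the rotation that takes
`E [f(X) f(X)]` at `t = 0` to `E [f(X) f(Y)]` at `t = π / 2`. -/
theorem variance_stdGaussian_le {f : E → ℝ} (hf : ContDiff ℝ 1 f) {C : ℝ}
    (hC : ∀ x, |f x| ≤ C) (hC' : ∀ x, ‖fderiv ℝ f x‖ ≤ C) :
    ∫ x, f x ^ 2 ∂stdGaussian E - (∫ x, f x ∂stdGaussian E) ^ 2
      ≤ ∫ x, ‖gradient f x‖ ^ 2 ∂stdGaussian E := by
  have hfc : Continuous f := hf.continuous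
  have hf'c : Continuous (fderiv ℝ f) := hf.continuous_fderiv one_ne_zero
  have hgc : Continuous (gradient f) := by
    unfold gradient
    exact (InnerProductSpace.toDual ℝ E).symm.continuous.comp hf'c
  have hgC : ∀ x, ‖gradient f x‖ ≤ C := by
    intro x
    simp only [gradient, LinearIsometryEquiv.norm_map]
    exact hC' x
  have hC0 : 0 ≤ C := (abs_nonneg _).trans (hC 0)
  set μ := stdGaussian E
  set D := ∫ x, ‖gradient f x‖ ^ 2 ∂μ with hD
  set Φ : ℝ → ℝ := fun t => ∫ z : E × E, f z.1 * f (Real.cos t • z.1 + Real.sin t • z.2)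
    ∂μ.prod μ with hΦ
  have hsq : Integrable (fun x => ‖gradient f x‖ ^ 2) μ :=
    Integrable.of_bound (by fun_prop) (C ^ 2) (Eventually.of_forall fun x => by
      rw [norm_pow, norm_norm]; gcongr; exact hgC x)
  have hder := hasDerivAt_integral_mul_comp_rotation hf hC hC'
  -- By Cauchy–Schwarz and rotation invariance, the correlation of the two gradients is at most `D`.
  have hcorr : ∀ t, ∫ z : E × E, inner ℝ (gradient f (Real.cos t • z.1 - Real.sin t • z.2))
      (gradient f z.1) ∂μ.prod μ ≤ D := by
    intro t
    have e1 : ∫ z : E × E, ‖gradient f z.1‖ ^ 2 ∂μ.prod μ = D := by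
      rw [integral_fun_fst (f := fun x => ‖gradient f x‖ ^ 2)]
      simp [hD]
    have e2 : ∫ z : E × E, ‖gradient f (Real.cos t • z.1 - Real.sin t • z.2)‖ ^ 2 ∂μ.prod μ
        = D := by
      have h := integral_comp_rotation_stdGaussian (-t)
        (H := fun z : E × E => ‖gradient f z.1‖ ^ 2) (by fun_prop)
      simp only [ContinuousLinearMap.rotation_apply, Real.cos_neg, Real.sin_neg, neg_smul,
        ← sub_eq_add_neg] at h
      exact h.trans e1
    have i1 : Integrable (fun z : E × E => ‖gradient f z.1‖ ^ 2) (μ.prod μ) := hsq.comp_fst μ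
    have i2 : Integrable (fun z : E × E =>
        ‖gradient f (Real.cos t • z.1 - Real.sin t • z.2)‖ ^ 2) (μ.prod μ) :=
      Integrable.of_bound (by fun_prop) (C ^ 2) (Eventually.of_forall fun x => by
        rw [norm_pow, norm_norm]; gcongr; exact hgC _)
    calc _ ≤ ∫ z : E × E, (1 / 2) * (‖gradient f (Real.cos t • z.1 - Real.sin t • z.2)‖ ^ 2
          + ‖gradient f z.1‖ ^ 2) ∂μ.prod μ := by
          refine integral_mono (Integrable.of_bound (by fun_prop) (C * C)
            (Eventually.of_forall fun z => ?_)) ((i2.add i1).const_mul _) fun z => ?_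
          · exact (norm_inner_le_norm _ _).trans (by gcongr <;> exact hgC _)
          · have h := real_inner_le_norm (gradient f (Real.cos t • z.1 - Real.sin t • z.2))
              (gradient f z.1)
            simp only
            nlinarith [sq_nonneg (‖gradient f (Real.cos t • z.1 - Real.sin t • z.2)‖
              - ‖gradient f z.1‖)]
      _ = D := by
          rw [integral_const_mul, integral_add i2 i1, e1, e2]; ring
  -- Hence the derivative of `Φ` is at least `-D sin t`.
  have hmono : MonotoneOn (fun t => Φ t - D * Real.cos t) (Set.Icc 0 (Real.pi / 2)) := by
    have hd : ∀ t, HasDerivAt (fun t => Φ t - D * Real.cos t) _ t := fun t =>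
      (hder t).sub ((Real.hasDerivAt_cos t).const_mul D)
    refine monotoneOn_of_deriv_nonneg (convex_Icc _ _)
      (fun t _ => (hd t).continuousAt.continuousWithinAt)
      (fun t _ => (hd t).differentiableAt.differentiableWithinAt) (fun t ht => ?_)
    rw [(hd t).deriv]
    rw [interior_Icc] at ht
    have hs : 0 ≤ Real.sin t :=
      Real.sin_nonneg_of_nonneg_of_le_pi ht.1.le (by linarith [ht.2, Real.pi_pos])
    have := mul_le_mul_of_nonneg_left (hcorr t) hs
    linarith
  have h := hmono (Set.left_mem_Icc.2 (by positivity)) (Set.right_mem_Icc.2 (by positivity))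
    (by positivity : (0 : ℝ) ≤ Real.pi / 2)
  have h0 : Φ 0 = ∫ x, f x ^ 2 ∂μ := by
    simp only [hΦ, Real.cos_zero, Real.sin_zero, one_smul, zero_smul, add_zero, ← pow_two]
    rw [integral_fun_fst (f := fun x => f x ^ 2)]
    simp
  have h1 : Φ (Real.pi / 2) = (∫ x, f x ∂μ) ^ 2 := by
    simp only [hΦ, Real.cos_pi_div_two, Real.sin_pi_div_two, one_smul, zero_smul, zero_add]
    rw [integral_prod_mul, pow_two]
  simp only [h0, h1, Real.cos_zero, Real.cos_pi_div_two] at h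
  linarith

end Gaussian

/-! ### Polar coordinates -/

section Polar

variable {E : Type*} [NormedAddCommGroup E] [NormedSpace ℝ E] [FiniteDimensional ℝ E]
  [MeasurableSpace E] [BorelSpace E]

theorem integral_volumeIoiPow (n : ℕ) (f : ℝ → ℝ) :
    ∫ r : Set.Ioi (0 : ℝ), f r ∂Measure.volumeIoiPow n = ∫ r in Set.Ioi (0 : ℝ), r ^ n * f r := by
  simp only [Measure.volumeIoiPow, ENNReal.ofReal]
  rw [integral_withDensity_eq_integral_smul,
    integral_subtype_comap measurableSet_Ioi fun a ↦ Real.toNNReal (a ^ n) • f a,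
    setIntegral_congr_fun measurableSet_Ioi fun x hx ↦ ?_]
  · rw [NNReal.smul_def, Real.coe_toNNReal _ (pow_nonneg hx.out.le _), smul_eq_mul]
  · exact (measurable_subtype_coe.pow_const _).real_toNNReal

theorem lintegral_volumeIoiPow (n : ℕ) {f : ℝ → ENNReal} (hf : Measurable f) :
    ∫⁻ r : Set.Ioi (0 : ℝ), f r ∂Measure.volumeIoiPow n
      = ∫⁻ r in Set.Ioi (0 : ℝ), ENNReal.ofReal (r ^ n) * f r := by
  rw [Measure.volumeIoiPow, lintegral_withDensity_eq_lintegral_mul _ (by fun_prop) (by fun_prop)]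
  exact lintegral_subtype_comap measurableSet_Ioi (fun r => ENNReal.ofReal (r ^ n) * f r)

/-- Polar coordinates for a function that separates into a radial and an angular factor. No
integrability is needed. -/
theorem integral_radial_mul_angular [Nontrivial E] (μ : Measure E) [μ.IsAddHaarMeasure]
    (p : ℝ → ℝ) (h : E → ℝ) :
    ∫ x, p ‖x‖ * h (‖x‖⁻¹ • x) ∂μ
      = (∫ r in Set.Ioi (0 : ℝ), r ^ (Module.finrank ℝ E - 1) * p r)
        * ∫ θ : sphere (0 : E) 1, h θ ∂μ.toSphere := by
  calc ∫ x, p ‖x‖ * h (‖x‖⁻¹ • x) ∂μ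
      = ∫ x : ({(0 : E)}ᶜ : Set E), p ‖x.1‖ * h (‖x.1‖⁻¹ • x.1) ∂(μ.comap (↑)) := by
        rw [integral_subtype_comap (measurableSet_singleton _).compl
          fun x ↦ p ‖x‖ * h (‖x‖⁻¹ • x), restrict_compl_singleton]
    _ = ∫ z : sphere (0 : E) 1 × Set.Ioi (0 : ℝ), h z.1 * p z.2
          ∂μ.toSphere.prod (.volumeIoiPow (Module.finrank ℝ E - 1)) := by
        rw [← μ.measurePreserving_homeomorphUnitSphereProd.integral_comp
          (Homeomorph.measurableEmbedding _)]
        refine integral_congr_ae (Eventually.of_forall fun x => ?_)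
        simp only [homeomorphUnitSphereProd_apply_snd_coe, homeomorphUnitSphereProd_apply_fst_coe]
        ring
    _ = _ := by
        rw [integral_prod_mul (fun θ : sphere (0 : E) 1 => h θ)
          (fun r : Set.Ioi (0 : ℝ) => p r), integral_volumeIoiPow, mul_comm]

theorem lintegral_eq_lintegral_prod_polar [Nontrivial E] (μ : Measure E) [μ.IsAddHaarMeasure]
    (F : E → ENNReal) :
    ∫⁻ x, F x ∂μ = ∫⁻ z : sphere (0 : E) 1 × Set.Ioi (0 : ℝ), F (z.2.1 • z.1.1)
      ∂μ.toSphere.prod (.volumeIoiPow (Module.finrank ℝ E - 1)) := by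
  rw [← μ.measurePreserving_homeomorphUnitSphereProd.lintegral_comp_emb
    (Homeomorph.measurableEmbedding _)]
  calc ∫⁻ x, F x ∂μ = ∫⁻ x in {(0 : E)}ᶜ, F x ∂μ := by rw [restrict_compl_singleton]
    _ = ∫⁻ x : ({(0 : E)}ᶜ : Set E), F x ∂(μ.comap (↑)) :=
        (lintegral_subtype_comap (measurableSet_singleton _).compl F).symm
    _ = _ := by
        refine lintegral_congr fun x => ?_
        simp only [homeomorphUnitSphereProd_apply_snd_coe,
          homeomorphUnitSphereProd_apply_fst_coe]
        rw [smul_inv_smul₀ (norm_ne_zero_iff.2 x.2)]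

theorem lintegral_polar [Nontrivial E] (μ : Measure E) [μ.IsAddHaarMeasure]
    {F : E → ENNReal} (hF : Measurable F) :
    ∫⁻ x, F x ∂μ = ∫⁻ θ : sphere (0 : E) 1, (∫⁻ r in Set.Ioi (0 : ℝ),
      ENNReal.ofReal (r ^ (Module.finrank ℝ E - 1)) * F (r • θ.1)) ∂μ.toSphere := by
  rw [lintegral_eq_lintegral_prod_polar, lintegral_prod _
    (by exact (hF.comp (by fun_prop)).aemeasurable)]
  refine lintegral_congr fun θ => ?_
  exact lintegral_volumeIoiPow _ (f := fun r => F (r • θ.1)) (hF.comp (by fun_prop))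

end Polar

/-! ### Separated functions -/

section Separated

variable {E : Type*} [NormedAddCommGroup E] [InnerProductSpace ℝ E]

/-- The function `|x|^s η(ε log |x|) g(x / |x|)`, separated into a radial profile, which is a power
cut off on a logarithmic scale, and an angular factor. -/
noncomputable def separated (s ε : ℝ) (η : ℝ → ℝ) (g : E → ℝ) (x : E) : ℝ :=
  ‖x‖ ^ s * η (ε * Real.log ‖x‖) * g (‖x‖⁻¹ • x)

/-- The squared norm of the component of `∇ g` orthogonal to `x`, for a unit vector `x`. On the unit
sphere this is the squared norm of the spherical gradient of `g`. -/
noncomputable def tangentialGradSq [CompleteSpace E] (g : E → ℝ) (x : E) : ℝ :=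
  ‖gradient g x‖ ^ 2 - inner ℝ (gradient g x) x ^ 2

variable {s ε : ℝ} {η : ℝ → ℝ} {g : E → ℝ}

/-- A separated function lives on an annulus. The hypothesis `h0` is needed at the origin, where
`Real.log 0 = 0` (and, for `s = 0`, `0 ^ 0 = 1`) would otherwise give a nonzero value. -/
theorem exists_annulus_separated (hη : HasCompactSupport η) (hε : 0 < ε)
    (h0 : (0 : ℝ) ^ s * η 0 = 0) :
    ∃ δ R : ℝ, 0 < δ ∧ ∀ x : E, separated s ε η g x ≠ 0 → δ ≤ ‖x‖ ∧ ‖x‖ ≤ R := by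
  obtain ⟨M, hM⟩ := hη.isCompact.isBounded.exists_norm_le
  refine ⟨Real.exp (-M / ε), Real.exp (M / ε), Real.exp_pos _, fun x hx => ?_⟩
  rcases eq_or_ne x 0 with rfl | hx0
  · simp [separated, h0] at hx
  have hn : 0 < ‖x‖ := norm_pos_iff.2 hx0
  have h1 : ε * Real.log ‖x‖ ∈ tsupport η := by
    refine subset_tsupport _ fun h => hx ?_
    rw [separated, h]; simp
  have h2 := abs_le.1 (hM _ h1)
  constructor
  · rw [← Real.le_log_iff_exp_le hn, div_le_iff₀ hε]; linarith
  · rw [← Real.log_le_iff_le_exp hn, le_div_iff₀ hε]; linarith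

theorem hasCompactSupport_separated [FiniteDimensional ℝ E] (hη : HasCompactSupport η)
    (hε : 0 < ε) (h0 : (0 : ℝ) ^ s * η 0 = 0) : HasCompactSupport (separated s ε η g) := by
  obtain ⟨δ, R, -, h⟩ := exists_annulus_separated (g := g) hη hε h0
  refine HasCompactSupport.intro (isCompact_closedBall (0 : E) R) fun x hx => ?_
  by_contra hne
  exact hx (mem_closedBall_zero_iff.2 (h x hne).2)

theorem contDiff_separated {n : ℕ∞} (hη : HasCompactSupport η) (hη' : ContDiff ℝ n η)
    (hg : ContDiff ℝ n g) (hε : 0 < ε) (h0 : (0 : ℝ) ^ s * η 0 = 0) :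
    ContDiff ℝ n (separated s ε η g) := by
  rw [contDiff_iff_contDiffAt]
  intro x
  rcases eq_or_ne x 0 with rfl | hx
  · obtain ⟨δ, R, hδ, h⟩ := exists_annulus_separated (g := g) hη hε h0
    refine contDiffAt_const (c := (0 : ℝ)).congr_of_eventuallyEq ?_
    filter_upwards [ball_mem_nhds (0 : E) hδ] with y hy
    by_contra hne
    exact absurd (h y hne).1 (not_le.2 (mem_ball_zero_iff.1 hy))
  · have hn : ‖x‖ ≠ 0 := norm_ne_zero_iff.2 hx
    have h1 : ContDiffAt ℝ n (fun y : E => ‖y‖) x := contDiffAt_norm ℝ hx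
    exact ((h1.rpow_const_of_ne hn).mul (hη'.contDiffAt.comp x
      (contDiffAt_const.mul (h1.log hn)))).mul
      (hg.contDiffAt.comp x ((h1.inv hn).smul contDiffAt_id))

theorem hasFDerivAt_norm {x : E} (hx : x ≠ 0) :
    HasFDerivAt (fun y : E => ‖y‖) (innerSL ℝ (‖x‖⁻¹ • x)) x := by
  have hn : ‖x‖ ≠ 0 := norm_ne_zero_iff.2 hx
  have h := ((hasStrictFDerivAt_norm_sq x).hasFDerivAt).sqrt (pow_ne_zero 2 hn)
  simp only [Real.sqrt_sq (norm_nonneg _)] at h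
  convert! h using 1
  ext y
  simp only [innerSL_apply_apply, inner_smul_left, FunLike.coe_smul, Pi.smul_apply,
    smul_eq_mul, nsmul_eq_mul]
  simp
  field_simp

/-- At `x = r e` with `r = ‖x‖`, the gradient of a separated function is the sum of its tangential
and its radial part. -/
theorem gradient_separated [CompleteSpace E] {x : E} (hx : x ≠ 0) (hη : Differentiable ℝ η)
    (hg : Differentiable ℝ g) :
    gradient (separated s ε η g) x
      = ‖x‖ ^ (s - 1) • (η (ε * Real.log ‖x‖) • (gradient g (‖x‖⁻¹ • x)
          - inner ℝ (gradient g (‖x‖⁻¹ • x)) (‖x‖⁻¹ • x) • (‖x‖⁻¹ • x))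
        + ((s * η (ε * Real.log ‖x‖) + ε * deriv η (ε * Real.log ‖x‖)) * g (‖x‖⁻¹ • x))
          • (‖x‖⁻¹ • x)) := by
  have hn : 0 < ‖x‖ := norm_pos_iff.2 hx
  set r := ‖x‖ with hr
  have h1 := hasFDerivAt_norm hx
  rw [← hr] at h1
  have h2 : HasDerivAt (fun ρ : ℝ => ρ ^ s * η (ε * Real.log ρ))
      (r ^ (s - 1) * (s * η (ε * Real.log r) + ε * deriv η (ε * Real.log r))) r := by
    have ha : HasDerivAt (fun ρ : ℝ => ρ ^ s) (s * r ^ (s - 1)) r :=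
      Real.hasDerivAt_rpow_const (Or.inl hn.ne')
    have hb : HasDerivAt (fun ρ : ℝ => η (ε * Real.log ρ))
        (deriv η (ε * Real.log r) * (ε * r⁻¹)) r :=
      (hη _).hasDerivAt.comp r ((Real.hasDerivAt_log hn.ne').const_mul ε)
    convert! ha.mul hb using 1
    have : r ^ s = r ^ (s - 1) * r := by
      rw [Real.rpow_sub_one hn.ne']; field_simp
    rw [this]
    field_simp
  have h3 : HasFDerivAt (fun y : E => ‖y‖⁻¹ • y)
      (r⁻¹ • ContinuousLinearMap.id ℝ E
        + ((-(r ^ 2)⁻¹) • innerSL ℝ (r⁻¹ • x)).smulRight x) x :=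
    (((hasDerivAt_inv hn.ne').comp_hasFDerivAt x h1)).smul (hasFDerivAt_id x)
  have h4 := (h2.comp_hasFDerivAt x h1).mul 
    (HasFDerivAt.comp (f := fun y : E => ‖y‖⁻¹ • y) x (hg (‖x‖⁻¹ • x)).hasFDerivAt h3)
  have h5 : HasFDerivAt (separated s ε η g)
      ((r ^ s * η (ε * Real.log r)) • (fderiv ℝ g (r⁻¹ • x)).comp
          (r⁻¹ • ContinuousLinearMap.id ℝ E
            + ((-(r ^ 2)⁻¹) • innerSL ℝ (r⁻¹ • x)).smulRight x)
        + g (r⁻¹ • x) • (r ^ (s - 1) * (s * η (ε * Real.log r) + ε * deriv η (ε * Real.log r)))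
          • innerSL ℝ (r⁻¹ • x)) x := h4
  refine ext_inner_right ℝ fun v => ?_
  have h6 : r ^ s = r ^ (s - 1) * r := by
    rw [Real.rpow_sub_one hn.ne']; field_simp
  have h7 : ∀ w : E, fderiv ℝ g (r⁻¹ • x) w = inner ℝ (gradient g (r⁻¹ • x)) w := by
    intro w; simp [gradient]
  have h8 : inner ℝ (gradient (separated s ε η g) x) v = fderiv ℝ (separated s ε η g) x v := by
    simp [gradient]
  rw [h8, h5.fderiv]
  simp only [add_apply, smul_apply, ContinuousLinearMap.comp_apply,
    ContinuousLinearMap.smulRight_apply, smul_eq_mul, innerSL_apply_apply, h7,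
    inner_add_left, inner_sub_left, inner_smul_left, inner_smul_right, inner_add_right,
    ContinuousLinearMap.id_apply, h6]
  simp only [conj_trivial]
  field_simp
  ring

theorem norm_gradient_separated_sq [CompleteSpace E] {x : E} (hx : x ≠ 0)
    (hη : Differentiable ℝ η) (hg : Differentiable ℝ g) :
    ‖gradient (separated s ε η g) x‖ ^ 2
      = (‖x‖ ^ (s - 1) * η (ε * Real.log ‖x‖)) ^ 2 * tangentialGradSq g (‖x‖⁻¹ • x)
        + (‖x‖ ^ (s - 1) * (s * η (ε * Real.log ‖x‖) + ε * deriv η (ε * Real.log ‖x‖))) ^ 2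
          * g (‖x‖⁻¹ • x) ^ 2 := by
  have hω : inner ℝ (‖x‖⁻¹ • x) (‖x‖⁻¹ • x) = (1 : ℝ) := by
    rw [real_inner_self_eq_norm_sq, norm_smul, norm_inv, norm_norm,
      inv_mul_cancel₀ (norm_ne_zero_iff.2 hx), one_pow]
  rw [gradient_separated hx hη hg, norm_smul, mul_pow, ← real_inner_self_eq_norm_sq (_ + _),
    Real.norm_eq_abs, sq_abs, tangentialGradSq, ← real_inner_self_eq_norm_sq (gradient _ _)]
  generalize ‖x‖⁻¹ • x = e at *
  simp only [inner_add_left, inner_add_right, inner_sub_left, inner_sub_right, inner_smul_left,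
    inner_smul_right, hω, conj_trivial, real_inner_comm e (gradient g e)]
  ring

end Separated

theorem integrableOn_mul_comp_log {w q : ℝ → ℝ} (hw : ContinuousOn w (Set.Ioi 0))
    (hq : Continuous q) (hq' : HasCompactSupport q) {ε : ℝ} (hε : 0 < ε) :
    IntegrableOn (fun r => w r * q (ε * Real.log r)) (Set.Ioi 0) := by
  obtain ⟨M, hM⟩ := hq'.isCompact.isBounded.exists_norm_le
  have hc : ContinuousOn (fun r => w r * q (ε * Real.log r)) (Set.Ioi 0) :=
    hw.mul (hq.comp_continuousOn (continuousOn_const.mul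
      (Real.continuousOn_log.mono fun r hr => (Set.mem_Ioi.1 hr).ne')))
  have h1 : IntegrableOn (fun r => w r * q (ε * Real.log r))
      (Set.Icc (Real.exp (-M / ε)) (Real.exp (M / ε))) :=
    (hc.mono fun r hr => (Real.exp_pos _).trans_le hr.1).integrableOn_Icc
  refine h1.of_forall_sdiff_eq_zero measurableSet_Ioi fun r hr => ?_
  by_contra hne
  refine hr.2 ?_
  have hr0 : 0 < r := hr.1
  have h2 := abs_le.1 (hM _ (subset_tsupport q (right_ne_zero_of_mul hne)))
  constructor
  · rw [← Real.le_log_iff_exp_le hr0, div_le_iff₀ hε]; linarith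
  · rw [← Real.log_le_iff_le_exp hr0, le_div_iff₀ hε]; linarith

section Separated

variable {E : Type*} [NormedAddCommGroup E] [InnerProductSpace ℝ E] [FiniteDimensional ℝ E]

theorem continuous_gradient {g : E → ℝ} (hg : ContDiff ℝ 1 g) : Continuous (gradient g) := by
  unfold gradient
  exact (InnerProductSpace.toDual ℝ E).symm.continuous.comp (hg.continuous_fderiv one_ne_zero)

theorem continuous_tangentialGradSq {g : E → ℝ} (hg : ContDiff ℝ 1 g) :
    Continuous (tangentialGradSq g) := by
  have := continuous_gradient hg
  unfold tangentialGradSq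
  fun_prop

theorem tangentialGradSq_sub_const (g : E → ℝ) (c : ℝ) (x : E) :
    tangentialGradSq (fun y => g y - c) x = tangentialGradSq g x := by
  simp only [tangentialGradSq, gradient, fderiv_sub_const]

variable [MeasurableSpace E] [BorelSpace E] [Nontrivial E]

theorem integrable_radial_mul_angular {p : ℝ → ℝ} {h : E → ℝ} (hh : Continuous h)
    (hp : IntegrableOn (fun r => r ^ (Module.finrank ℝ E - 1) * p r) (Set.Ioi 0)) :
    Integrable fun x : E => p ‖x‖ * h (‖x‖⁻¹ • x) := by
  have h1 : Integrable (fun x : E => p ‖x‖) := (integrable_fun_norm_addHaar volume).2 hp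
  obtain ⟨M, hM⟩ := (isCompact_closedBall (0 : E) 1).exists_bound_of_continuousOn hh.continuousOn
  refine h1.mul_bdd (c := M) (hh.measurable.comp (by fun_prop)).aestronglyMeasurable
    (Eventually.of_forall fun x => hM _ ?_)
  rw [mem_closedBall_zero_iff, norm_smul, norm_inv, norm_norm]
  exact inv_mul_le_one

/-- The weighted Dirichlet integral of a separated function. The weight is `e^(-r² / 2)` in the proof
of the Poincaré inequality on the sphere, and `1` in the proof of sharpness. -/
theorem integral_norm_gradient_separated_sq {s ε : ℝ} {η : ℝ → ℝ} {g : E → ℝ} {w : ℝ → ℝ}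
    (hw : ContinuousOn w (Set.Ioi 0)) (hη : HasCompactSupport η) (hη' : ContDiff ℝ 1 η)
    (hg : ContDiff ℝ 1 g) (hε : 0 < ε) :
    ∫ x : E, w ‖x‖ * ‖gradient (separated s ε η g) x‖ ^ 2
      = (∫ r in Set.Ioi (0 : ℝ), r ^ (Module.finrank ℝ E - 1) * (w r * (r ^ (s - 1)
            * η (ε * Real.log r)) ^ 2))
          * ∫ θ : sphere (0 : E) 1, tangentialGradSq g θ ∂(volume : Measure E).toSphere
        + (∫ r in Set.Ioi (0 : ℝ), r ^ (Module.finrank ℝ E - 1) * (w r * (r ^ (s - 1)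
            * (s * η (ε * Real.log r) + ε * deriv η (ε * Real.log r))) ^ 2))
          * ∫ θ : sphere (0 : E) 1, g θ ^ 2 ∂(volume : Measure E).toSphere := by
  have hη'c : Continuous (deriv η) := hη'.continuous_deriv le_rfl
  have key : ∀ q : ℝ → ℝ, Continuous q → HasCompactSupport q → IntegrableOn (fun r : ℝ =>
      r ^ (Module.finrank ℝ E - 1) * (w r * (r ^ (s - 1) * q (ε * Real.log r)) ^ 2))
      (Set.Ioi 0) := by
    intro q hq hq'
    have h := integrableOn_mul_comp_log (w := fun r => r ^ (Module.finrank ℝ E - 1) * w r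
      * (r ^ (s - 1)) ^ 2) (q := fun t => q t ^ 2)
      (((continuousOn_id.pow _).mul hw).mul ((continuousOn_id.rpow_const
        fun r hr => Or.inl (Set.mem_Ioi.1 hr).ne').pow 2)) (by fun_prop)
      (hq'.comp_left (g := fun t : ℝ => t ^ 2) (by simp)) hε
    refine h.congr_fun (fun r _ => ?_) measurableSet_Ioi
    simp only
    ring
  rw [← integral_radial_mul_angular volume (fun r => w r * (r ^ (s - 1) * η (ε * Real.log r)) ^ 2),
    ← integral_radial_mul_angular volume (fun r => w r * (r ^ (s - 1)
      * (s * η (ε * Real.log r) + ε * deriv η (ε * Real.log r))) ^ 2) (fun x => g x ^ 2),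
    ← integral_add]
  · refine integral_congr_ae ?_
    filter_upwards [compl_mem_ae_iff.2 (measure_singleton (0 : E))] with x hx
    rw [norm_gradient_separated_sq hx (hη'.differentiable one_ne_zero)
      (hg.differentiable one_ne_zero)]
    ring
  · exact integrable_radial_mul_angular (continuous_tangentialGradSq hg)
      (key η hη'.continuous hη)
  · refine integrable_radial_mul_angular (hg.continuous.pow 2)
      (key (fun t => s * η t + ε * deriv η t) (by fun_prop) ?_)
    exact (hη.comp_left (g := fun t => s * t) (by simp)).add
      (hη.deriv.comp_left (g := fun t => ε * t) (by simp))

end Separated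

/-! ### The Poincaré inequality on the sphere -/

/-- The radial Gaussian moment `∫_0^∞ r^k e^{-r²/2} dr`. -/
noncomputable def gaussianMoment (k : ℕ) : ℝ :=
  ∫ r in Set.Ioi (0 : ℝ), r ^ k * Real.exp (-(1 / 2) * r ^ 2)

theorem integrableOn_gaussianMoment (k : ℕ) :
    IntegrableOn (fun r : ℝ => r ^ k * Real.exp (-(1 / 2) * r ^ 2)) (Set.Ioi 0) := by
  have := integrableOn_rpow_mul_exp_neg_mul_sq (b := 1 / 2) (by norm_num) (s := k)
    (by linarith [k.cast_nonneg (α := ℝ)])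
  simpa using this

theorem gaussianMoment_eq (k : ℕ) : gaussianMoment k
    = (1 / 2 : ℝ) ^ (-(k + 1 : ℝ) / 2) * (1 / 2) * Real.Gamma ((k + 1) / 2) := by
  have := integral_rpow_mul_exp_neg_mul_rpow (p := 2) (q := k) (b := 1 / 2) (by norm_num)
    (by linarith [k.cast_nonneg (α := ℝ)]) (by norm_num)
  rw [← this, gaussianMoment]
  simp

theorem gaussianMoment_pos (k : ℕ) : 0 < gaussianMoment k := by
  rw [gaussianMoment_eq]
  have := Real.Gamma_pos_of_pos (s := (k + 1 : ℝ) / 2) (by positivity)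
  positivity

/-- The recursion behind `E |X|² = N`, the source of the constant `N - 1`. -/
theorem gaussianMoment_add_two (k : ℕ) :
    gaussianMoment (k + 2) = (k + 1) * gaussianMoment k := by
  rw [gaussianMoment_eq, gaussianMoment_eq]
  have h1 : ((k + 2 : ℕ) + 1 : ℝ) / 2 = (k + 1) / 2 + 1 := by push_cast; ring
  have h2 : -((k + 2 : ℕ) + 1 : ℝ) / 2 = -(k + 1) / 2 - 1 := by push_cast; ring
  rw [h1, h2, Real.Gamma_add_one (by positivity), Real.rpow_sub_one (by norm_num)]
  ring

theorem tendsto_integral_gaussianMoment (k : ℕ) {φ : ℕ → ℝ → ℝ} {K : ℝ}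
    (hm : ∀ n, Measurable (φ n)) (hK : ∀ n r, |φ n r| ≤ K)
    (hlim : ∀ r, Tendsto (fun n => φ n r) atTop (𝓝 1)) :
    Tendsto (fun n => ∫ r in Set.Ioi (0 : ℝ), r ^ k * Real.exp (-(1 / 2) * r ^ 2) * φ n r)
      atTop (𝓝 (gaussianMoment k)) := by
  refine tendsto_integral_of_dominated_convergence
    (fun r => r ^ k * Real.exp (-(1 / 2) * r ^ 2) * K) (fun n => ?_)
    ((integrableOn_gaussianMoment k).mul_const K) (fun n => ?_) ?_
  · exact Measurable.aestronglyMeasurable (by have := hm n; fun_prop)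
  · refine (ae_restrict_iff' measurableSet_Ioi).2 (Eventually.of_forall fun r hr => ?_)
    have hr0 : 0 < r := hr
    rw [norm_mul, Real.norm_of_nonneg (by positivity)]
    gcongr
    exact hK n r
  · refine Eventually.of_forall fun r => ?_
    simpa only [mul_one] using (hlim r).const_mul (r ^ k * Real.exp (-(1 / 2) * r ^ 2))

section Sphere

open ProbabilityTheory

variable {E : Type*} [NormedAddCommGroup E] [InnerProductSpace ℝ E] [FiniteDimensional ℝ E]
  [MeasurableSpace E] [BorelSpace E] [Nontrivial E]

/-- The Gaussian Poincaré inequality for a separated function with angular factor of mean zero,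
in polar coordinates. -/
theorem gaussian_poincare_separated {ε : ℝ} {η : ℝ → ℝ} {g : E → ℝ}
    (hη : HasCompactSupport η) (hη' : ContDiff ℝ 1 η) (hg : ContDiff ℝ 1 g) (hε : 0 < ε)
    (hmean : ∫ θ : sphere (0 : E) 1, g θ ∂(volume : Measure E).toSphere = 0) :
    (∫ r in Set.Ioi (0 : ℝ), r ^ (Module.finrank ℝ E - 1 + 2) * Real.exp (-(1 / 2) * r ^ 2)
          * η (ε * Real.log r) ^ 2)
        * ∫ θ : sphere (0 : E) 1, g θ ^ 2 ∂(volume : Measure E).toSphere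
      ≤ (∫ r in Set.Ioi (0 : ℝ), r ^ (Module.finrank ℝ E - 1) * Real.exp (-(1 / 2) * r ^ 2)
          * η (ε * Real.log r) ^ 2)
          * ∫ θ : sphere (0 : E) 1, tangentialGradSq g θ ∂(volume : Measure E).toSphere
        + (∫ r in Set.Ioi (0 : ℝ), r ^ (Module.finrank ℝ E - 1) * Real.exp (-(1 / 2) * r ^ 2)
          * (η (ε * Real.log r) + ε * deriv η (ε * Real.log r)) ^ 2)
          * ∫ θ : sphere (0 : E) 1, g θ ^ 2 ∂(volume : Measure E).toSphere := by
  obtain ⟨c, hc, hμ⟩ := stdGaussian_eq_withDensity (E := E)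
  have hval : ∀ h : E → ℝ, ∫ x, h x ∂stdGaussian E
      = c * ∫ x, Real.exp (-(1 / 2) * ‖x‖ ^ 2) * h x := by
    intro h
    rw [hμ, integral_withDensity_eq_integral_toReal_smul (by fun_prop)
      (Eventually.of_forall fun x => ENNReal.ofReal_lt_top), ← integral_const_mul]
    congr 1; ext x
    rw [ENNReal.toReal_ofReal (by positivity), smul_eq_mul, mul_assoc]
  set F : E → ℝ := separated 1 ε η g with hF
  have h0 : (0 : ℝ) ^ (1 : ℝ) * η 0 = 0 := by simp
  have hFsmooth : ContDiff ℝ 1 F := contDiff_separated (n := 1) hη hη' hg hε h0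
  have hFs : HasCompactSupport F := hasCompactSupport_separated hη hε h0
  obtain ⟨C₁, hC₁⟩ := hFs.exists_bound_of_continuous hFsmooth.continuous
  obtain ⟨C₂, hC₂⟩ := (hFs.fderiv ℝ).exists_bound_of_continuous
    (hFsmooth.continuous_fderiv one_ne_zero)
  have key := variance_stdGaussian_le hFsmooth (C := max C₁ C₂)
    (fun x => (hC₁ x).trans (le_max_left _ _)) (fun x => (hC₂ x).trans (le_max_right _ _))
  have e0 : ∫ x, F x ∂stdGaussian E = 0 := by
    have := integral_radial_mul_angular (volume : Measure E)
      (fun r => Real.exp (-(1 / 2) * r ^ 2) * (r ^ (1 : ℝ) * η (ε * Real.log r))) g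
    rw [hmean, mul_zero] at this
    rw [hval, mul_eq_zero]
    right
    rw [← this]
    congr 1; ext x
    rw [hF, separated]; ring
  have e1 : ∫ x, F x ^ 2 ∂stdGaussian E = c * ((∫ r in Set.Ioi (0 : ℝ),
      r ^ (Module.finrank ℝ E - 1 + 2) * Real.exp (-(1 / 2) * r ^ 2)
          * η (ε * Real.log r) ^ 2)
        * ∫ θ : sphere (0 : E) 1, g θ ^ 2 ∂(volume : Measure E).toSphere) := by
    have := integral_radial_mul_angular (volume : Measure E)
      (fun r => Real.exp (-(1 / 2) * r ^ 2) * (r * η (ε * Real.log r)) ^ 2) (fun x => g x ^ 2)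
    rw [hval]
    congr 1
    refine Eq.trans ?_ (this.trans ?_)
    · congr 1; ext x
      rw [hF, separated, Real.rpow_one]; ring
    · congr 2; ext r; ring
  have e2 := integral_norm_gradient_separated_sq (E := E) (s := 1)
    (w := fun r => Real.exp (-(1 / 2) * r ^ 2)) (by fun_prop) hη hη' hg hε
  rw [e0, e1, hval, e2] at key
  rw [zero_pow two_ne_zero, sub_zero] at key
  refine (le_of_mul_le_mul_left key hc).trans (le_of_eq ?_)
  simp only [sub_self, Real.rpow_zero, one_mul]
  congr 3 <;> (ext r; ring)

/-- As the logarithmic cutoff is removed, `gaussian_poincare_separated` becomes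
`M_{N+1} ∫ g² ≤ M_{N-1} (∫ |∇_ω g|² + ∫ g²)`, where `M_{N+1} = N M_{N-1}`. -/
theorem sphere_poincare_of_integral_eq_zero {g : E → ℝ} (hg : ContDiff ℝ 1 g)
    (hmean : ∫ θ : sphere (0 : E) 1, g θ ∂(volume : Measure E).toSphere = 0) :
    ((Module.finrank ℝ E : ℝ) - 1)
        * ∫ θ : sphere (0 : E) 1, g θ ^ 2 ∂(volume : Measure E).toSphere
      ≤ ∫ θ : sphere (0 : E) 1, tangentialGradSq g θ ∂(volume : Measure E).toSphere := by
  -- All that matters is `η 0 = 1`, so that `η (ε log r) → 1` as `ε → 0`.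
  let η : ContDiffBump (0 : ℝ) := ⟨1, 2, one_pos, one_lt_two⟩
  set m := Module.finrank ℝ E - 1 with hm
  have hm' : (Module.finrank ℝ E : ℝ) = m + 1 := by
    rw [hm, Nat.cast_sub Module.finrank_pos]; simp
  have hηc : HasCompactSupport (η : ℝ → ℝ) := η.hasCompactSupport
  have hη1 : ContDiff ℝ 1 (η : ℝ → ℝ) := η.contDiff
  have hη' : Continuous (deriv (η : ℝ → ℝ)) := hη1.continuous_deriv le_rfl
  obtain ⟨K, hK⟩ := hηc.deriv.exists_bound_of_continuous hη'
  have hε : ∀ n : ℕ, (0 : ℝ) < 1 / (n + 1) := fun n => by positivity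
  have hε1 : ∀ n : ℕ, 1 / ((n : ℝ) + 1) ≤ 1 := fun n => by
    rw [div_le_one (by positivity)]; linarith [n.cast_nonneg (α := ℝ)]
  have hε0 := tendsto_one_div_add_atTop_nhds_zero_nat (𝕜 := ℝ)
  have hlog : ∀ r : ℝ, Tendsto (fun n : ℕ => 1 / ((n : ℝ) + 1) * Real.log r) atTop (𝓝 0) :=
    fun r => by simpa using hε0.mul_const (Real.log r)
  have hη_one : (η : ℝ → ℝ) 0 = 1 := η.one_of_mem_closedBall (by simp [η])
  have l1 : ∀ r : ℝ, Tendsto (fun n : ℕ => η (1 / ((n : ℝ) + 1) * Real.log r)) atTop (𝓝 1) :=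
    fun r => by
      have := (hη1.continuous.tendsto 0).comp (hlog r)
      rwa [hη_one] at this
  have l2 : ∀ r : ℝ, Tendsto (fun n : ℕ => 1 / ((n : ℝ) + 1)
      * deriv η (1 / ((n : ℝ) + 1) * Real.log r)) atTop (𝓝 0) := fun r => by
    simpa using hε0.mul ((hη'.tendsto 0).comp (hlog r))
  have t1 : ∀ k : ℕ, Tendsto (fun n : ℕ => ∫ r in Set.Ioi (0 : ℝ), r ^ k
      * Real.exp (-(1 / 2) * r ^ 2) * η (1 / ((n : ℝ) + 1) * Real.log r) ^ 2) atTop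
      (𝓝 (gaussianMoment k)) := fun k => by
    refine tendsto_integral_gaussianMoment k (K := 1) (fun n => ?_) (fun n r => ?_) fun r => ?_
    · have := hη1.continuous.measurable
      fun_prop
    · rw [abs_of_nonneg (sq_nonneg _)]
      exact pow_le_one₀ η.nonneg η.le_one
    · simpa using (l1 r).pow 2
  have t2 : Tendsto (fun n : ℕ => ∫ r in Set.Ioi (0 : ℝ), r ^ m
      * Real.exp (-(1 / 2) * r ^ 2) * (η (1 / ((n : ℝ) + 1) * Real.log r)
        + 1 / ((n : ℝ) + 1) * deriv η (1 / ((n : ℝ) + 1) * Real.log r)) ^ 2) atTop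
      (𝓝 (gaussianMoment m)) := by
    refine tendsto_integral_gaussianMoment m (K := (1 + K) ^ 2) (fun n => ?_) (fun n r => ?_)
      fun r => ?_
    · have h1 := hη1.continuous.measurable
      have h2 := hη'.measurable
      fun_prop
    · rw [abs_pow]
      gcongr
      refine (abs_add_le _ _).trans ?_
      gcongr
      · rw [abs_of_nonneg η.nonneg]; exact η.le_one
      · rw [abs_mul, abs_of_pos (hε n)]
        exact (mul_le_of_le_one_left (abs_nonneg _) (hε1 n)).trans (hK _)
    · simpa using ((l1 r).add (l2 r)).pow 2
  have key := le_of_tendsto_of_tendsto'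
    ((t1 (m + 2)).mul_const (∫ θ : sphere (0 : E) 1, g θ ^ 2 ∂(volume : Measure E).toSphere))
    (((t1 m).mul_const _).add (t2.mul_const _))
    (fun n => gaussian_poincare_separated hηc hη1 hg (hε n) hmean)
  rw [gaussianMoment_add_two] at key
  refine le_of_mul_le_mul_left ?_ (gaussianMoment_pos m)
  rw [hm']
  linarith

/-- The Poincaré inequality on the unit sphere, with its sharp constant `N - 1`. -/
theorem sphere_poincare {g : E → ℝ} (hg : ContDiff ℝ 1 g) :
    ((Module.finrank ℝ E : ℝ) - 1) * ∫ θ : sphere (0 : E) 1,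
        (g θ - (∫ θ : sphere (0 : E) 1, g θ ∂(volume : Measure E).toSphere)
          / (volume : Measure E).toSphere.real Set.univ) ^ 2 ∂(volume : Measure E).toSphere
      ≤ ∫ θ : sphere (0 : E) 1, tangentialGradSq g θ ∂(volume : Measure E).toSphere := by
  set σ := (volume : Measure E).toSphere
  set c := (∫ θ : sphere (0 : E) 1, g θ ∂σ) / σ.real Set.univ with hc
  have hσ : σ.real Set.univ ≠ 0 := by
    rw [measureReal_def, ENNReal.toReal_ne_zero]
    exact ⟨Measure.measure_univ_ne_zero.2 (Measure.toSphere_ne_zero _), measure_ne_top _ _⟩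
  have hint : Integrable (fun θ : sphere (0 : E) 1 => g θ) σ :=
    (hg.continuous.comp continuous_subtype_val).integrable_of_hasCompactSupport
      (HasCompactSupport.of_compactSpace _)
  have h := sphere_poincare_of_integral_eq_zero (g := fun x => g x - c) (hg.sub contDiff_const) (by
    rw [integral_sub hint (integrable_const c), integral_const, smul_eq_mul, hc,
      mul_div_cancel₀ _ hσ, sub_self])
  simpa only [tangentialGradSq_sub_const] using h

end Sphere

/-! ### The improved radial Hardy inequality -/

theorem one_le_log_exp_div {r : ℝ} (hr : 0 < r) (hr1 : r ≤ 1) :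
    1 ≤ Real.log (Real.exp 1 / r) := by
  rw [Real.log_div (Real.exp_ne_zero 1) hr.ne', Real.log_exp]
  linarith [Real.log_nonpos hr.le hr1]

theorem hasDerivAt_log_exp_div {r : ℝ} (hr : 0 < r) :
    HasDerivAt (fun r => Real.log (Real.exp 1 / r)) (-r⁻¹) r := by
  have h : HasDerivAt (fun r : ℝ => 1 - Real.log r) (-r⁻¹) r := by
    simpa using (Real.hasDerivAt_log hr.ne').const_sub 1
  refine h.congr_of_eventuallyEq ?_
  filter_upwards [Ioi_mem_nhds hr] with x hx
  rw [Real.log_div (Real.exp_ne_zero 1) (ne_of_gt hx), Real.log_exp]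

theorem continuousOn_log_exp_div :
    ContinuousOn (fun r => Real.log (Real.exp 1 / r)) (Set.Ioi 0) := fun _ hr =>
  (hasDerivAt_log_exp_div hr).continuousAt.continuousWithinAt

/-- The improved Hardy inequality on `[δ, 1]`. It comes from expanding the square of `f' + h f`,
where `h = a / r + 1 / (2 r log (e / r))` is minus the logarithmic derivative of the positive
solution `r ^ (-a) (log (e / r)) ^ (1 / 2)` of the Euler–Lagrange equation. The boundary term at
`δ` has the favourable sign, so `f` need not vanish there. -/
theorem integral_hardy_log_le {f : ℝ → ℝ} (hf : ContDiff ℝ 1 f) (hf1 : f 1 = 0) {m : ℕ}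
    (hm : 1 ≤ m) {δ : ℝ} (hδ : 0 < δ) (hδ1 : δ ≤ 1) :
    ∫ r in δ..1, r ^ m * ((((m - 1) / 2) ^ 2 + 1 / (4 * Real.log (Real.exp 1 / r) ^ 2))
        * (f r ^ 2 / r ^ 2))
      ≤ ∫ r in δ..1, r ^ m * deriv f r ^ 2 := by
  set a : ℝ := (m - 1) / 2 with ha
  have ha0 : 0 ≤ a := by
    have : (1 : ℝ) ≤ m := by exact_mod_cast hm
    rw [ha]; linarith
  set L : ℝ → ℝ := fun r => Real.log (Real.exp 1 / r) with hL
  have hLpos : ∀ r ∈ Set.Icc δ 1, 0 < L r := fun r hr =>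
    one_pos.trans_le (one_le_log_exp_div (hδ.trans_le hr.1) hr.2)
  have hpos : ∀ r ∈ Set.Icc δ 1, 0 < r := fun r hr => hδ.trans_le hr.1
  have hLc : ContinuousOn L (Set.Icc δ 1) := continuousOn_log_exp_div.mono hpos
  have hfc : Continuous f := hf.continuous
  have hf'c : Continuous (deriv f) := hf.continuous_deriv le_rfl
  set Q : ℝ → ℝ := fun r => (a / r + 1 / (2 * r * L r)) * r ^ m * f r ^ 2 with hQ
  have hA : ContinuousOn (fun r => r ^ m * ((a ^ 2 + 1 / (4 * L r ^ 2)) * (f r ^ 2 / r ^ 2)))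
      (Set.Icc δ 1) := by
    refine ContinuousOn.mul (by fun_prop) (ContinuousOn.mul (continuousOn_const.add
      (continuousOn_const.div (by fun_prop) fun r hr => ?_))
      (ContinuousOn.div (by fun_prop) (by fun_prop) fun r hr => ?_))
    · have := hLpos r hr; positivity
    · have := hpos r hr; positivity
  have hB : ContinuousOn (fun r => r ^ m * deriv f r ^ 2) (Set.Icc δ 1) := by fun_prop
  have hQ' : ∀ r ∈ Set.Icc δ 1, HasDerivAt (fun r => -Q r)
      (r ^ m * deriv f r ^ 2 - r ^ m * ((a ^ 2 + 1 / (4 * L r ^ 2)) * (f r ^ 2 / r ^ 2))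
        - r ^ m * (deriv f r + (a / r + 1 / (2 * r * L r)) * f r) ^ 2) r := by
    intro r hr
    have hr0 := hpos r hr
    have hl := hLpos r hr
    have d1 : HasDerivAt f (deriv f r) r := (hf.differentiable one_ne_zero r).hasDerivAt
    have d2 : HasDerivAt L (-r⁻¹) r := hasDerivAt_log_exp_div hr0
    have d3 : HasDerivAt (fun r : ℝ => a / r + 1 / (2 * r * L r)) _ r :=
      ((hasDerivAt_const r a).div (hasDerivAt_id r) hr0.ne').add
        ((hasDerivAt_const r (1 : ℝ)).div (((hasDerivAt_id r).const_mul 2).mul d2)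
          (by positivity))
    have d4 := (((d3.mul (hasDerivAt_pow m r)).mul (d1.pow 2))).neg
    convert! d4 using 1
    have hm' : (m : ℝ) = 2 * a + 1 := by rw [ha]; ring
    obtain ⟨k, rfl⟩ : ∃ k, m = k + 1 := ⟨m - 1, by omega⟩
    simp only [id, Pi.mul_apply, Pi.pow_apply, add_tsub_cancel_right, hm']
    field_simp
    ring
  have hi : ∀ {g : ℝ → ℝ}, ContinuousOn g (Set.Icc δ 1) → IntervalIntegrable g volume δ 1 :=
    fun hg => ContinuousOn.intervalIntegrable (by rwa [Set.uIcc_of_le hδ1])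
  have hS : ContinuousOn (fun r => r ^ m * (deriv f r + (a / r + 1 / (2 * r * L r)) * f r) ^ 2)
      (Set.Icc δ 1) := by
    refine ContinuousOn.mul (by fun_prop) (ContinuousOn.pow (hf'c.continuousOn.add
      (ContinuousOn.mul ((continuousOn_const.div continuousOn_id fun r hr => (hpos r hr).ne').add
        (continuousOn_const.div (by fun_prop) fun r hr => ?_)) hfc.continuousOn)) 2)
    have := hLpos r hr
    have := hpos r hr
    positivity
  have hFTC := intervalIntegral.integral_eq_sub_of_hasDerivAt
    (fun r hr => hQ' r (by rwa [Set.uIcc_of_le hδ1] at hr)) ((hi hB).sub (hi hA) |>.sub (hi hS))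
  rw [intervalIntegral.integral_sub ((hi hB).sub (hi hA)) (hi hS),
    intervalIntegral.integral_sub (hi hB) (hi hA)] at hFTC
  have hQ1 : Q 1 = 0 := by simp [hQ, hf1]
  have hQδ : 0 ≤ Q δ := by
    have := hLpos δ ⟨le_rfl, hδ1⟩
    simp only [hQ]
    positivity
  have hS0 : 0 ≤ ∫ r in δ..1, r ^ m * (deriv f r + (a / r + 1 / (2 * r * L r)) * f r) ^ 2 :=
    intervalIntegral.integral_nonneg hδ1 fun r hr => by
      have := hpos r hr
      positivity
  linarith

/-- The improved Hardy inequality on `(0, 1)`. Both sides may be infinite. -/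
theorem lintegral_hardy_log_le {f : ℝ → ℝ} (hf : ContDiff ℝ 1 f) (hf1 : f 1 = 0) {m : ℕ}
    (hm : 1 ≤ m) :
    ∫⁻ r in Set.Ioo (0 : ℝ) 1, ENNReal.ofReal (r ^ m *
        ((((m - 1) / 2) ^ 2 + 1 / (4 * Real.log (Real.exp 1 / r) ^ 2)) * (f r ^ 2 / r ^ 2)))
      ≤ ∫⁻ r in Set.Ioo (0 : ℝ) 1, ENNReal.ofReal (r ^ m * deriv f r ^ 2) := by
  have hf'c : Continuous (deriv f) := hf.continuous_deriv le_rfl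
  have hU : Set.Ioo (0 : ℝ) 1 = ⋃ n : ℕ, Set.Ioo (1 / ((n : ℝ) + 1)) 1 := by
    ext r
    simp only [Set.mem_Ioo, Set.mem_iUnion]
    refine ⟨fun h => ?_, fun ⟨n, h1, h2⟩ => ⟨(by positivity : (0 : ℝ) < _).trans h1, h2⟩⟩
    obtain ⟨n, hn⟩ := exists_nat_one_div_lt h.1
    exact ⟨n, hn, h.2⟩
  have hdir : Directed (· ⊆ ·) fun n : ℕ => Set.Ioo (1 / ((n : ℝ) + 1)) 1 :=
    directed_of_isDirected_le fun i j hij => Set.Ioo_subset_Ioo_left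
      (one_div_le_one_div_of_le (by positivity) (by gcongr))
  conv_lhs => rw [hU, setLIntegral_iUnion_of_directed _ hdir]
  refine iSup_le fun n => ?_
  have hδ : (0 : ℝ) < 1 / (n + 1) := by positivity
  have hδ1 : 1 / ((n : ℝ) + 1) ≤ 1 := by
    rw [div_le_one (by positivity)]; linarith [n.cast_nonneg (α := ℝ)]
  set δ : ℝ := 1 / (n + 1)
  have key := integral_hardy_log_le hf hf1 hm hδ hδ1
  rw [intervalIntegral.integral_of_le hδ1, intervalIntegral.integral_of_le hδ1,
    integral_Ioc_eq_integral_Ioo, integral_Ioc_eq_integral_Ioo] at key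
  have hB : IntegrableOn (fun r => r ^ m * deriv f r ^ 2) (Set.Ioo δ 1) :=
    (ContinuousOn.integrableOn_Icc (by fun_prop)).mono_set Set.Ioo_subset_Icc_self
  have hLc := continuousOn_log_exp_div
  have hA : IntegrableOn (fun r => r ^ m * ((((m - 1) / 2) ^ 2
      + 1 / (4 * Real.log (Real.exp 1 / r) ^ 2)) * (f r ^ 2 / r ^ 2))) (Set.Ioo δ 1) := by
    refine (ContinuousOn.integrableOn_Icc ?_).mono_set Set.Ioo_subset_Icc_self
    have hpos : ∀ r ∈ Set.Icc δ 1, 0 < r := fun r hr => hδ.trans_le hr.1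
    refine ContinuousOn.mul (by fun_prop) (ContinuousOn.mul (continuousOn_const.add
      (continuousOn_const.div (continuousOn_const.mul ((hLc.mono hpos).pow 2)) fun r hr => ?_))
      (ContinuousOn.div (hf.continuous.continuousOn.pow 2) (by fun_prop) fun r hr => ?_))
    · have := one_le_log_exp_div (hpos r hr) hr.2; positivity
    · have := hpos r hr; positivity
  have hpos : ∀ᵐ r ∂(volume.restrict (Set.Ioo δ 1)), 0 < r :=
    (ae_restrict_iff' measurableSet_Ioo).2 (Eventually.of_forall fun r hr => hδ.trans hr.1)
  rw [← ofReal_integral_eq_lintegral_ofReal hA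
    (hpos.mono fun r hr => by simp only [Pi.zero_apply]; positivity)]
  refine (ENNReal.ofReal_le_ofReal key).trans ?_
  rw [ofReal_integral_eq_lintegral_ofReal hB
    (hpos.mono fun r hr => by simp only [Pi.zero_apply]; positivity)]
  exact lintegral_mono_set (Set.Ioo_subset_Ioo_left hδ.le)

/-! ### The Hardy inequality with remainder for test functions -/

theorem setLIntegral_Ioi_indicator_ball {E : Type*} [NormedAddCommGroup E] [NormedSpace ℝ E]
    (m : ℕ) (F : E → ENNReal) (θ : sphere (0 : E) 1) :
    ∫⁻ r in Set.Ioi (0 : ℝ), ENNReal.ofReal (r ^ m) * (ball (0 : E) 1).indicator F (r • θ.1)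
      = ∫⁻ r in Set.Ioo (0 : ℝ) 1, ENNReal.ofReal (r ^ m) * F (r • θ.1) := by
  rw [← Set.Ioi_inter_Iio, Set.inter_comm, ← setLIntegral_indicator measurableSet_Iio]
  refine setLIntegral_congr_fun measurableSet_Ioi fun r hr => ?_
  have hn : ‖r • θ.1‖ = r := by
    rw [norm_smul, mem_sphere_zero_iff_norm.1 θ.2, mul_one, Real.norm_of_nonneg (le_of_lt hr)]
  by_cases h : r < 1 <;> simp [Set.indicator, hn, h]

section Ball

variable {E : Type*} [NormedAddCommGroup E] [NormedSpace ℝ E] [FiniteDimensional ℝ E]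
  [MeasurableSpace E] [BorelSpace E] [Nontrivial E] (μ : Measure E) [μ.IsAddHaarMeasure]

theorem lintegral_ball_polar {F : E → ENNReal} (hF : Measurable F) :
    ∫⁻ x in ball 0 1, F x ∂μ = ∫⁻ θ : sphere (0 : E) 1, (∫⁻ r in Set.Ioo (0 : ℝ) 1,
      ENNReal.ofReal (r ^ (Module.finrank ℝ E - 1)) * F (r • θ.1)) ∂μ.toSphere := by
  rw [← lintegral_indicator measurableSet_ball,
    lintegral_polar μ (hF.indicator measurableSet_ball)]
  simp only [setLIntegral_Ioi_indicator_ball]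

theorem lintegral_ball_polar_symm {F : E → ENNReal} (hF : Measurable F) :
    ∫⁻ x in ball 0 1, F x ∂μ = ∫⁻ r in Set.Ioo (0 : ℝ) 1,
      ENNReal.ofReal (r ^ (Module.finrank ℝ E - 1)) *
        ∫⁻ θ : sphere (0 : E) 1, F (r • θ.1) ∂μ.toSphere := by
  rw [lintegral_ball_polar μ hF, lintegral_lintegral_swap]
  · refine lintegral_congr fun r => ?_
    exact lintegral_const_mul _ (hF.comp (by fun_prop))
  · exact (Measurable.mul (by fun_prop) (hF.comp (by fun_prop))).aemeasurable

end Ball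

section TestFunction

variable {N : ℕ}

/-- The average of `u` over the sphere of radius `r`. -/
noncomputable def sphereMean (u : EuclideanSpace ℝ (Fin N) → ℝ) (r : ℝ) : ℝ :=
  sphereIntegral u r
    / (volume : Measure (EuclideanSpace ℝ (Fin N))).toSphere.real Set.univ

/-- The Hardy weight `(N - 2)² / 4 + 1 / (4 log² (e / r))`, to be multiplied by `r⁻²`. -/
noncomputable def hardyWeight (N : ℕ) (r : ℝ) : ℝ :=
  (((N : ℝ) - 2) / 2) ^ 2 + 1 / (4 * Real.log (Real.exp 1 / r) ^ 2)

theorem measurable_hardyWeight : Measurable (hardyWeight N) := by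
  unfold hardyWeight; fun_prop

theorem hardyWeight_nonneg (r : ℝ) : 0 ≤ hardyWeight N r := by
  unfold hardyWeight; positivity

theorem measurable_sphereIntegral {u : EuclideanSpace ℝ (Fin N) → ℝ} (hu : Measurable u) :
    Measurable (sphereIntegral u) := by
  have h : StronglyMeasurable fun z : ℝ × sphere (0 : EuclideanSpace ℝ (Fin N)) 1 =>
      u (z.1 • z.2.1) := (hu.comp (by fun_prop)).stronglyMeasurable
  exact h.integral_prod_right.measurable

theorem measurable_sphereMean {u : EuclideanSpace ℝ (Fin N) → ℝ} (hu : Measurable u) :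
    Measurable (sphereMean u) := (measurable_sphereIntegral hu).div_const _

theorem norm_smul_sphere {r : ℝ} (hr : 0 < r)
    (θ : sphere (0 : EuclideanSpace ℝ (Fin N)) 1) : ‖r • θ.1‖ = r := by
  rw [norm_smul, mem_sphere_zero_iff_norm.1 θ.2, mul_one, Real.norm_of_nonneg hr.le]

theorem hasDerivAt_comp_smul {u : EuclideanSpace ℝ (Fin N) → ℝ} (hu : Differentiable ℝ u)
    (θ : EuclideanSpace ℝ (Fin N)) (r : ℝ) :
    HasDerivAt (fun r : ℝ => u (r • θ)) (inner ℝ (gradient u (r • θ)) θ) r := by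
  have h := (hu (r • θ)).hasFDerivAt.comp_hasDerivAt r ((hasDerivAt_id r).smul_const θ)
  convert! h using 1
  simp [gradient]

/-- The radial inequality, integrated over all directions. -/
theorem lintegral_radial_hardy_le (hN : 2 ≤ N) {φ : EuclideanSpace ℝ (Fin N) → ℝ}
    (hφ : IsTestFunction φ) :
    ∫⁻ x in ball 0 1, ENNReal.ofReal (hardyWeight N ‖x‖ * (φ x ^ 2 / ‖x‖ ^ 2))
      ≤ ∫⁻ x in ball 0 1, ENNReal.ofReal (inner ℝ (gradient φ x) (‖x‖⁻¹ • x) ^ 2) := by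
  have : Nontrivial (EuclideanSpace ℝ (Fin N)) := by
    have : Nonempty (Fin N) := ⟨⟨0, by omega⟩⟩
    infer_instance
  have hφ1 : ContDiff ℝ 1 φ := hφ.smooth.of_le (by exact_mod_cast le_top)
  have hφm : Measurable φ := hφ1.continuous.measurable
  have hgm : Measurable (gradient φ) := (continuous_gradient hφ1).measurable
  have hwm := measurable_hardyWeight (N := N)
  rw [lintegral_ball_polar _ (by fun_prop), lintegral_ball_polar _ (by fun_prop)]
  refine lintegral_mono fun θ => ?_
  simp only [finrank_euclideanSpace_fin]
  have hf : ContDiff ℝ 1 fun r : ℝ => φ (r • θ.1) := by fun_prop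
  have hf1 : φ ((1 : ℝ) • θ.1) = 0 := by
    refine image_eq_zero_of_notMem_tsupport fun h => ?_
    have := hφ.tsupport_subset h
    rw [mem_ball_zero_iff, norm_smul_sphere one_pos] at this
    exact lt_irrefl _ this
  have key := lintegral_hardy_log_le hf hf1 (m := N - 1) (by omega)
  have hcast : ((N - 1 : ℕ) : ℝ) - 1 = N - 2 := by
    rw [Nat.cast_sub (by omega)]; push_cast; ring
  refine (le_of_eq ?_).trans (key.trans (le_of_eq ?_)) <;>
  · refine setLIntegral_congr_fun measurableSet_Ioo fun r hr => ?_
    have hr0 : 0 < r := hr.1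
    simp only [norm_smul_sphere hr0, (hasDerivAt_comp_smul (hφ1.differentiable one_ne_zero)
      θ.1 r).deriv, hardyWeight, hcast, inv_smul_smul₀ hr0.ne']
    rw [← ENNReal.ofReal_mul (by positivity)]

theorem tangentialGradSq_comp_smul {u : EuclideanSpace ℝ (Fin N) → ℝ} (hu : Differentiable ℝ u)
    (r : ℝ) (x : EuclideanSpace ℝ (Fin N)) :
    tangentialGradSq (fun x => u (r • x)) x
      = r ^ 2 * (‖gradient u (r • x)‖ ^ 2 - inner ℝ (gradient u (r • x)) x ^ 2) := by
  have h : gradient (fun x => u (r • x)) x = r • gradient u (r • x) := by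
    refine ext_inner_right ℝ fun v => ?_
    have h1 : HasFDerivAt (fun x => u (r • x)) ((fderiv ℝ u (r • x)).comp
        (r • ContinuousLinearMap.id ℝ _)) x :=
      HasFDerivAt.comp (f := fun x => r • x) x (hu (r • x)).hasFDerivAt
        ((hasFDerivAt_id x).const_smul r)
    simp [gradient, h1.fderiv, inner_smul_left]
  rw [tangentialGradSq, h, norm_smul, inner_smul_left, mul_pow, mul_pow, Real.norm_eq_abs, sq_abs]
  simp only [conj_trivial]
  ring

/-- The Poincaré inequality on each sphere of radius `r`, integrated over `r`. -/
theorem lintegral_tangential_poincare_le (hN : 2 ≤ N) {φ : EuclideanSpace ℝ (Fin N) → ℝ}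
    (hφ : IsTestFunction φ) :
    ∫⁻ x in ball 0 1, ENNReal.ofReal (((N : ℝ) - 1) * ((φ x - sphereMean φ ‖x‖) ^ 2 / ‖x‖ ^ 2))
      ≤ ∫⁻ x in ball 0 1, ENNReal.ofReal (‖gradient φ x‖ ^ 2
          - inner ℝ (gradient φ x) (‖x‖⁻¹ • x) ^ 2) := by
  have : Nontrivial (EuclideanSpace ℝ (Fin N)) := by
    have : Nonempty (Fin N) := ⟨⟨0, by omega⟩⟩
    infer_instance
  have hφ1 : ContDiff ℝ 1 φ := hφ.smooth.of_le (by exact_mod_cast le_top)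
  have hφm : Measurable φ := hφ1.continuous.measurable
  have hgc := continuous_gradient hφ1
  have hgm : Measurable (gradient φ) := hgc.measurable
  have hMm := measurable_sphereMean hφm
  rw [lintegral_ball_polar_symm _ (by fun_prop), lintegral_ball_polar_symm _ (by fun_prop)]
  refine setLIntegral_mono' measurableSet_Ioo fun r hr => ?_
  gcongr 1
  have hr0 : 0 < r := hr.1
  have hg : ContDiff ℝ 1 fun x => φ (r • x) := by fun_prop
  have key := sphere_poincare hg
  set σ := (volume : Measure (EuclideanSpace ℝ (Fin N))).toSphere
  have hcont : ∀ {h : sphere (0 : EuclideanSpace ℝ (Fin N)) 1 → ℝ}, Continuous h →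
      Integrable h σ := fun hh =>
    hh.integrable_of_hasCompactSupport (HasCompactSupport.of_compactSpace _)
  have hM : (∫ θ : sphere (0 : EuclideanSpace ℝ (Fin N)) 1, φ (r • θ.1) ∂σ) / σ.real Set.univ
      = sphereMean φ r := rfl
  have hN1 : (0 : ℝ) ≤ N - 1 := by
    have : (2 : ℝ) ≤ N := by exact_mod_cast hN
    linarith
  simp only [hM, tangentialGradSq_comp_smul (hφ1.differentiable one_ne_zero),
    finrank_euclideanSpace_fin] at key
  -- The factor `r ^ 2` in `key` comes from rescaling the sphere of radius `r` to the unit sphere.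
  simp only [norm_smul_sphere hr0, inv_smul_smul₀ hr0.ne']
  rw [← ofReal_integral_eq_lintegral_ofReal (hcont (by fun_prop))
      (Eventually.of_forall fun θ => by simp only [Pi.zero_apply]; positivity),
    ← ofReal_integral_eq_lintegral_ofReal (hcont (by fun_prop))
      (Eventually.of_forall fun θ => ?_)]
  · refine ENNReal.ofReal_le_ofReal ?_
    rw [integral_const_mul] at key ⊢
    rw [integral_div]
    rw [mul_div_assoc', div_le_iff₀ (by positivity)]
    linarith
  · have h := abs_real_inner_le_norm (gradient φ (r • θ.1)) θ.1
    rw [mem_sphere_zero_iff_norm.1 θ.2, mul_one] at h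
    simp only [Pi.zero_apply, sub_nonneg]
    exact sq_le_sq' (by linarith [neg_abs_le (inner ℝ (gradient φ (r • θ.1)) θ.1)])
      ((le_abs_self _).trans h)

/-- The Hardy inequality with remainder for all test functions: the deviation from the spherical
means contributes the tangential Poincaré constant. -/
theorem lintegral_hardy_add_le (hN : 2 ≤ N) {φ : EuclideanSpace ℝ (Fin N) → ℝ}
    (hφ : IsTestFunction φ) :
    ∫⁻ x in ball 0 1, ENNReal.ofReal (hardyWeight N ‖x‖ * (φ x ^ 2 / ‖x‖ ^ 2)
        + ((N : ℝ) - 1) * ((φ x - sphereMean φ ‖x‖) ^ 2 / ‖x‖ ^ 2))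
      ≤ ∫⁻ x in ball 0 1, ‖gradient φ x‖ₑ ^ 2 := by
  have hφ1 : ContDiff ℝ 1 φ := hφ.smooth.of_le (by exact_mod_cast le_top)
  have hφm : Measurable φ := hφ1.continuous.measurable
  have hgm : Measurable (gradient φ) := (continuous_gradient hφ1).measurable
  have hMm := measurable_sphereMean hφm
  have hwm := measurable_hardyWeight (N := N)
  have hN1 : (0 : ℝ) ≤ N - 1 := by
    have : (2 : ℝ) ≤ N := by exact_mod_cast hN
    linarith
  calc _ = ∫⁻ x in ball 0 1, (ENNReal.ofReal (hardyWeight N ‖x‖ * (φ x ^ 2 / ‖x‖ ^ 2))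
        + ENNReal.ofReal (((N : ℝ) - 1) * ((φ x - sphereMean φ ‖x‖) ^ 2 / ‖x‖ ^ 2))) := by
        refine lintegral_congr fun x => ENNReal.ofReal_add ?_ (by positivity)
        have := hardyWeight_nonneg (N := N) ‖x‖
        positivity
    _ ≤ ∫⁻ x in ball 0 1, (ENNReal.ofReal (inner ℝ (gradient φ x) (‖x‖⁻¹ • x) ^ 2)
        + ENNReal.ofReal (‖gradient φ x‖ ^ 2 - inner ℝ (gradient φ x) (‖x‖⁻¹ • x) ^ 2)) := by
        rw [lintegral_add_left (by fun_prop), lintegral_add_left (by fun_prop)]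
        exact add_le_add (lintegral_radial_hardy_le hN hφ)
          (lintegral_tangential_poincare_le hN hφ)
    _ = _ := by
        refine lintegral_congr fun x => ?_
        have h : inner ℝ (gradient φ x) (‖x‖⁻¹ • x) ^ 2 ≤ ‖gradient φ x‖ ^ 2 := by
          rw [← sq_abs]
          gcongr
          refine (abs_real_inner_le_norm _ _).trans (mul_le_of_le_one_right (norm_nonneg _) ?_)
          rw [norm_smul, norm_inv, norm_norm]
          exact inv_mul_le_one
        rw [← ENNReal.ofReal_add (sq_nonneg _) (sub_nonneg.2 h), add_sub_cancel,
          ENNReal.ofReal_pow (norm_nonneg _), ofReal_norm]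

end TestFunction

/-! ### Passage to the energy space -/

section EnergySpace

variable {N : ℕ}

theorem nontrivial_euclideanSpace_of_two_le (hN : 2 ≤ N) :
    Nontrivial (EuclideanSpace ℝ (Fin N)) := by
  have : Nonempty (Fin N) := ⟨⟨0, by omega⟩⟩
  infer_instance

theorem sq_eLpNorm_two {α F : Type*} [MeasurableSpace α] [NormedAddCommGroup F] (μ : Measure α)
    (f : α → F) : eLpNorm f 2 μ ^ 2 = ∫⁻ x, ‖f x‖ₑ ^ 2 ∂μ := by
  rw [eLpNorm_eq_lintegral_rpow_enorm_toReal two_ne_zero ENNReal.ofNat_ne_top,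
    ← ENNReal.rpow_natCast, ← ENNReal.rpow_mul]
  simp

theorem measurable_lintegral_sphere {F : EuclideanSpace ℝ (Fin N) → ENNReal} (hF : Measurable F) :
    Measurable fun r : ℝ => ENNReal.ofReal
      (r ^ (Module.finrank ℝ (EuclideanSpace ℝ (Fin N)) - 1)) *
      ∫⁻ θ : sphere (0 : EuclideanSpace ℝ (Fin N)) 1, F (r • θ.1)
        ∂(volume : Measure (EuclideanSpace ℝ (Fin N))).toSphere :=
  Measurable.mul (by fun_prop) (Measurable.lintegral_prod_right' (f := fun z : ℝ × sphere
      (0 : EuclideanSpace ℝ (Fin N)) 1 => F (z.1 • z.2.1)) (hF.comp (by fun_prop)))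

/-- A null set of the ball meets almost every sphere in a null set. -/
theorem ae_ae_sphere_of_ae_ball [Nontrivial (EuclideanSpace ℝ (Fin N))]
    {P : EuclideanSpace ℝ (Fin N) → Prop}
    (h : ∀ᵐ x ∂(volume.restrict (ball 0 1)), P x) :
    ∀ᵐ r ∂(volume.restrict (Set.Ioo (0 : ℝ) 1)),
      ∀ᵐ θ : sphere (0 : EuclideanSpace ℝ (Fin N)) 1
        ∂(volume : Measure (EuclideanSpace ℝ (Fin N))).toSphere, P (r • θ.1) := by
  obtain ⟨s, hs, hsm, hs0⟩ := exists_measurable_superset_of_null (ae_iff.1 h)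
  have hm : Measurable (s.indicator (1 : EuclideanSpace ℝ (Fin N) → ENNReal)) :=
    measurable_one.indicator hsm
  have h0 := lintegral_ball_polar_symm (volume : Measure (EuclideanSpace ℝ (Fin N))) hm
  rw [lintegral_indicator_one hsm, hs0, eq_comm, 
    lintegral_eq_zero_iff (measurable_lintegral_sphere hm)] at h0
  filter_upwards [h0, ae_restrict_mem measurableSet_Ioo] with r hr hr'
  have hr0 : 0 < r := hr'.1
  have h1 : ENNReal.ofReal (r ^ (Module.finrank ℝ (EuclideanSpace ℝ (Fin N)) - 1)) ≠ 0 :=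
    (ENNReal.ofReal_pos.2 (by positivity)).ne'
  have h2 := (mul_eq_zero.1 hr).resolve_left h1
  have hmr : Measurable fun θ : sphere (0 : EuclideanSpace ℝ (Fin N)) 1 =>
      s.indicator (1 : EuclideanSpace ℝ (Fin N) → ENNReal) (r • θ.1) := hm.comp (by fun_prop)
  rw [lintegral_eq_zero_iff hmr] at h2
  filter_upwards [h2] with θ hθ
  by_contra hP
  have : r • θ.1 ∈ s := hs hP
  simp [this] at hθ

theorem toSphere_real_univ_pos [Nontrivial (EuclideanSpace ℝ (Fin N))] :
    0 < (volume : Measure (EuclideanSpace ℝ (Fin N))).toSphere.real Set.univ := by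
  rw [measureReal_def]
  exact ENNReal.toReal_pos (Measure.measure_univ_ne_zero.2 (Measure.toSphere_ne_zero _))
    (measure_ne_top _ _)

/-- The spherical means of `φ` are bounded in `L^1` by the distance from `φ` to any integrable `u`
whose spherical means vanish, since they are also the spherical means of `φ - u`. -/
theorem lintegral_sphereMean_le [Nontrivial (EuclideanSpace ℝ (Fin N))]
    {φ u : EuclideanSpace ℝ (Fin N) → ℝ} (hφ : Continuous φ) (hu : Measurable u)
    (hu1 : ∫⁻ x in ball 0 1, ‖u x‖ₑ ≠ ⊤)
    (hmean : ∀ᵐ r ∂(volume.restrict (Set.Ioo (0 : ℝ) 1)), sphereIntegral u r = 0) :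
    ∫⁻ x in ball (0 : EuclideanSpace ℝ (Fin N)) 1, ‖sphereMean φ ‖x‖‖ₑ
      ≤ ∫⁻ x in ball 0 1, ‖φ x - u x‖ₑ := by
  have hMm := measurable_sphereMean hφ.measurable
  have hφm := hφ.measurable
  set σ := (volume : Measure (EuclideanSpace ℝ (Fin N))).toSphere with hσ
  -- For almost every `r` the restriction of `u` to the sphere is integrable, so that
  -- `sphereIntegral u r = 0` is not a junk value.
  have hfin : ∀ᵐ r ∂(volume.restrict (Set.Ioo (0 : ℝ) 1)),
      ∫⁻ θ : sphere (0 : EuclideanSpace ℝ (Fin N)) 1, ‖u (r • θ.1)‖ₑ ∂σ < ⊤ := by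
    rw [lintegral_ball_polar_symm _ (by fun_prop)] at hu1
    have h1 := ae_lt_top (measurable_lintegral_sphere hu.enorm) hu1
    filter_upwards [h1, ae_restrict_mem measurableSet_Ioo] with r hr hr'
    have hr0 : 0 < r := hr'.1
    by_contra hne
    rw [not_lt, top_le_iff] at hne
    refine hr.ne ?_
    rw [hne, ENNReal.mul_top (ENNReal.ofReal_pos.2 (by positivity)).ne']
  rw [lintegral_ball_polar_symm _ (by fun_prop), lintegral_ball_polar_symm _ (by fun_prop)]
  refine lintegral_mono_ae ?_
  filter_upwards [hmean, hfin, ae_restrict_mem measurableSet_Ioo] with r hr hrf hr'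
  have hr0 : 0 < r := hr'.1
  gcongr 1
  simp only [norm_smul_sphere hr0]
  have hui : Integrable (fun θ : sphere (0 : EuclideanSpace ℝ (Fin N)) 1 => u (r • θ.1)) σ :=
    ⟨(hu.comp (by fun_prop)).aestronglyMeasurable, hrf⟩
  have hφi : Integrable (fun θ : sphere (0 : EuclideanSpace ℝ (Fin N)) 1 => φ (r • θ.1)) σ :=
    (by fun_prop : Continuous _).integrable_of_hasCompactSupport
      (HasCompactSupport.of_compactSpace _)
  have hI : sphereIntegral φ r = ∫ θ : sphere (0 : EuclideanSpace ℝ (Fin N)) 1,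
      (φ (r • θ.1) - u (r • θ.1)) ∂σ := by
    rw [integral_sub hφi hui]
    change _ = sphereIntegral φ r - sphereIntegral u r
    rw [hr, sub_zero]
  have hσ0 := toSphere_real_univ_pos (N := N)
  rw [← hσ] at hσ0
  have hσe : ENNReal.ofReal (σ.real Set.univ) = σ Set.univ := ofReal_measureReal
  calc ∫⁻ _ : sphere (0 : EuclideanSpace ℝ (Fin N)) 1, ‖sphereMean φ r‖ₑ ∂σ
      = ‖sphereMean φ r‖ₑ * ‖σ.real Set.univ‖ₑ := by
        rw [lintegral_const, ← hσe, Real.enorm_of_nonneg hσ0.le]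
    _ = ‖sphereIntegral φ r‖ₑ := by
        rw [← enorm_mul, sphereMean, div_mul_cancel₀ _ hσ0.ne']
    _ ≤ _ := by
        rw [hI]
        exact enorm_integral_le_lintegral_enorm _

/-- The improved Hardy inequality for measurable functions in the energy space, by Fatou's lemma.
The two terms on the left have the sum `(N² / 4 + 1 / (4 log² (e / |x|))) u² / |x|²`. -/
theorem lintegral_hardy_le_of_measurable (hN : 2 ≤ N) {u : EuclideanSpace ℝ (Fin N) → ℝ}
    {G : EuclideanSpace ℝ (Fin N) → EuclideanSpace ℝ (Fin N)} (hu : IsH10WithGradient u G)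
    (hum : Measurable u)
    (hmean : ∀ᵐ r ∂(volume.restrict (Set.Ioo (0 : ℝ) 1)), sphereIntegral u r = 0) :
    ∫⁻ x in ball 0 1, ENNReal.ofReal (hardyWeight N ‖x‖ * (u x ^ 2 / ‖x‖ ^ 2)
        + ((N : ℝ) - 1) * (u x ^ 2 / ‖x‖ ^ 2))
      ≤ eLpNorm G 2 (volume.restrict (ball 0 1)) ^ 2 := by
  have := nontrivial_euclideanSpace_of_two_le hN
  obtain ⟨φ, hφ, hφu, hφG⟩ := hu.exists_approx
  set ν : Measure (EuclideanSpace ℝ (Fin N)) := volume.restrict (ball 0 1) with hν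
  have : IsFiniteMeasure ν := ⟨by rw [hν, Measure.restrict_apply_univ]; exact measure_ball_lt_top⟩
  have hφ1 : ∀ n, ContDiff ℝ 1 (φ n) := fun n => (hφ n).smooth.of_le (by exact_mod_cast le_top)
  have hφm : ∀ n, Measurable (φ n) := fun n => (hφ1 n).continuous.measurable
  have hMm : ∀ n, Measurable (sphereMean (φ n)) := fun n => measurable_sphereMean (hφm n)
  have hwm := measurable_hardyWeight (N := N)
  have hone : ∀ f : EuclideanSpace ℝ (Fin N) → ℝ, Measurable f →
      eLpNorm f 1 ν ≤ eLpNorm f 2 ν * ν Set.univ ^ (1 / (1 : ENNReal).toReal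
        - 1 / (2 : ENNReal).toReal) := fun f hf =>
    eLpNorm_le_eLpNorm_mul_rpow_measure_univ one_le_two hf.aestronglyMeasurable
  have hc : ν Set.univ ^ (1 / (1 : ENNReal).toReal - 1 / (2 : ENNReal).toReal) ≠ ⊤ :=
    ENNReal.rpow_ne_top_of_nonneg (by norm_num) (measure_ne_top _ _)
  have hu1 : ∫⁻ x in ball 0 1, ‖u x‖ₑ ≠ ⊤ := by
    rw [← eLpNorm_one_eq_lintegral_enorm]
    exact ((hone u hum).trans_lt (ENNReal.mul_lt_top hu.memLp.2 hc.lt_top)).ne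
  have hφu1 : Tendsto (fun n => eLpNorm (fun x => φ n x - u x) 1 ν) atTop (𝓝 0) := by
    refine tendsto_of_tendsto_of_tendsto_of_le_of_le tendsto_const_nhds ?_ (fun n => zero_le)
      (fun n => hone _ ((hφm n).sub hum))
    simpa using ENNReal.Tendsto.mul_const hφu (Or.inr hc)
  have hM1 : Tendsto (fun n => eLpNorm (fun x => sphereMean (φ n) ‖x‖) 1 ν) atTop (𝓝 0) := by
    refine tendsto_of_tendsto_of_tendsto_of_le_of_le tendsto_const_nhds hφu1 (fun n => zero_le)
      (fun n => ?_)
    simp only [eLpNorm_one_eq_lintegral_enorm]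
    exact lintegral_sphereMean_le (hφ1 n).continuous hum hu1 hmean
  -- Pass to a subsequence along which the functions and their spherical means converge a.e.
  have hmeas1 : TendstoInMeasure ν φ atTop u :=
    tendstoInMeasure_of_tendsto_eLpNorm one_ne_zero (fun n => (hφm n).aestronglyMeasurable)
      hum.aestronglyMeasurable hφu1
  obtain ⟨k, hk, hkae⟩ := hmeas1.exists_seq_tendsto_ae
  have hmeas2 : TendstoInMeasure ν (fun n x => sphereMean (φ (k n)) ‖x‖) atTop (fun _ => 0) :=
    tendstoInMeasure_of_tendsto_eLpNorm one_ne_zero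
      (fun n => ((hMm _).comp measurable_norm).aestronglyMeasurable) aestronglyMeasurable_const
      (by simp only [Pi.sub_def, sub_zero]; exact hM1.comp hk.tendsto_atTop)
  obtain ⟨l, hl, hlae⟩ := hmeas2.exists_seq_tendsto_ae
  set ψ : ℕ → EuclideanSpace ℝ (Fin N) → ℝ := fun n => φ (k (l n)) with hψ
  have hlim : ∀ᵐ x ∂ν, liminf (fun n => ENNReal.ofReal (hardyWeight N ‖x‖
      * (ψ n x ^ 2 / ‖x‖ ^ 2)
        + ((N : ℝ) - 1) * ((ψ n x - sphereMean (ψ n) ‖x‖) ^ 2 / ‖x‖ ^ 2))) atTop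
      = ENNReal.ofReal (hardyWeight N ‖x‖ * (u x ^ 2 / ‖x‖ ^ 2)
        + ((N : ℝ) - 1) * (u x ^ 2 / ‖x‖ ^ 2)) := by
    filter_upwards [hkae, hlae] with x hx1 hx2
    have hx1' : Tendsto (fun n => ψ n x) atTop (𝓝 (u x)) := hx1.comp hl.tendsto_atTop
    refine Tendsto.liminf_eq (ENNReal.tendsto_ofReal ?_)
    have h3 := ((hx1'.sub hx2).pow 2).div_const (‖x‖ ^ 2)
    rw [sub_zero] at h3
    exact (((hx1'.pow 2).div_const _).const_mul _).add (h3.const_mul _)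
  have hGm := hu.memLp_grad.aestronglyMeasurable
  have hub : Tendsto (fun n => (eLpNorm (fun x => gradient (ψ n) x - G x) 2 ν
      + eLpNorm G 2 ν) ^ 2) atTop (𝓝 (eLpNorm G 2 ν ^ 2)) := by
    have := ((hφG.comp (hk.comp hl).tendsto_atTop).add_const (eLpNorm G 2 ν))
    rw [zero_add] at this
    exact ENNReal.Tendsto.pow this
  calc ∫⁻ x in ball 0 1, ENNReal.ofReal (hardyWeight N ‖x‖ * (u x ^ 2 / ‖x‖ ^ 2)
        + ((N : ℝ) - 1) * (u x ^ 2 / ‖x‖ ^ 2))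
      = ∫⁻ x, liminf (fun n => ENNReal.ofReal (hardyWeight N ‖x‖ * (ψ n x ^ 2 / ‖x‖ ^ 2)
        + ((N : ℝ) - 1) * ((ψ n x - sphereMean (ψ n) ‖x‖) ^ 2 / ‖x‖ ^ 2))) atTop ∂ν :=
        (lintegral_congr_ae hlim).symm
    _ ≤ liminf (fun n => ∫⁻ x, ENNReal.ofReal (hardyWeight N ‖x‖ * (ψ n x ^ 2 / ‖x‖ ^ 2)
        + ((N : ℝ) - 1) * ((ψ n x - sphereMean (ψ n) ‖x‖) ^ 2 / ‖x‖ ^ 2)) ∂ν) atTop := by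
        refine lintegral_liminf_le fun n => ?_
        have h1 := hφm (k (l n))
        have h2 := hMm (k (l n))
        fun_prop
    _ ≤ liminf (fun n => (eLpNorm (fun x => gradient (ψ n) x - G x) 2 ν
      + eLpNorm G 2 ν) ^ 2) atTop := by
        refine liminf_le_liminf (Eventually.of_forall fun n => ?_)
        refine (lintegral_hardy_add_le hN (hφ (k (l n)))).trans ?_
        have hgm : AEStronglyMeasurable (gradient (ψ n)) ν :=
          (continuous_gradient (hφ1 (k (l n)))).aestronglyMeasurable
        rw [← sq_eLpNorm_two]
        gcongr
        have h2 := eLpNorm_add_le (hgm.sub hGm) hGm (one_le_two (α := ENNReal))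
        rwa [sub_add_cancel] at h2
    _ = eLpNorm G 2 ν ^ 2 := hub.liminf_eq

/-- The improved Hardy inequality in the energy space. -/
theorem integral_hardy_le (hN : 2 ≤ N) {u : EuclideanSpace ℝ (Fin N) → ℝ}
    {G : EuclideanSpace ℝ (Fin N) → EuclideanSpace ℝ (Fin N)} (hu : IsH10WithGradient u G)
    (hmean : ∀ᵐ r ∂(volume.restrict (Set.Ioo (0 : ℝ) 1)), sphereIntegral u r = 0) :
    IntegrableOn (fun x => |u x| ^ 2 / ‖x‖ ^ 2) (ball 0 1) ∧
    IntegrableOn (fun x => |u x| ^ 2 / (‖x‖ ^ 2 * Real.log (Real.exp 1 / ‖x‖) ^ 2)) (ball 0 1) ∧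
    (N : ℝ) ^ 2 / 4 * (∫ x in ball 0 1, |u x| ^ 2 / ‖x‖ ^ 2)
        + 1 / 4 * ∫ x in ball 0 1, |u x| ^ 2 / (‖x‖ ^ 2 * Real.log (Real.exp 1 / ‖x‖) ^ 2)
      ≤ ∫ x in ball 0 1, ‖G x‖ ^ 2 := by
  have := nontrivial_euclideanSpace_of_two_le hN
  set ν : Measure (EuclideanSpace ℝ (Fin N)) := volume.restrict (ball 0 1) with hν
  have hum := hu.memLp.aestronglyMeasurable.aemeasurable
  -- Replace `u` by a Borel representative, which has the same spherical means for almost every `r`.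
  set v := hum.mk u with hv
  have hvm : Measurable v := hum.measurable_mk
  have huv : u =ᵐ[ν] v := hum.ae_eq_mk
  have hv10 : IsH10WithGradient v G := by
    obtain ⟨φ, h1, h2, h3⟩ := hu.exists_approx
    refine ⟨(memLp_congr_ae huv).1 hu.memLp, hu.memLp_grad, φ, h1, h2.congr fun n => ?_, h3⟩
    refine eLpNorm_congr_ae ?_
    filter_upwards [huv] with x hx
    rw [hx]
  have hvmean : ∀ᵐ r ∂(volume.restrict (Set.Ioo (0 : ℝ) 1)), sphereIntegral v r = 0 := by
    filter_upwards [hmean, ae_ae_sphere_of_ae_ball huv] with r hr hr'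
    rw [← hr]
    exact integral_congr_ae (hr'.mono fun θ h => h.symm)
  have key := lintegral_hardy_le_of_measurable hN hv10 hvm hvmean
  have hlog : ∀ᵐ x ∂ν, ‖x‖ ≠ 0 ∧ 1 ≤ Real.log (Real.exp 1 / ‖x‖) := by
    filter_upwards [ae_restrict_mem measurableSet_ball,
      ae_restrict_of_ae (compl_mem_ae_iff.2 (measure_singleton 0))] with x hx hx0
    have h0 : 0 < ‖x‖ := norm_pos_iff.2 hx0
    exact ⟨h0.ne', one_le_log_exp_div h0 (mem_ball_zero_iff.1 hx).le⟩
  set A : EuclideanSpace ℝ (Fin N) → ℝ := fun x => |u x| ^ 2 / ‖x‖ ^ 2 with hA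
  set B : EuclideanSpace ℝ (Fin N) → ℝ :=
    fun x => |u x| ^ 2 / (‖x‖ ^ 2 * Real.log (Real.exp 1 / ‖x‖) ^ 2) with hB
  have hAm : AEStronglyMeasurable A ν :=
    (by fun_prop : AEMeasurable A ν).aestronglyMeasurable
  have hBm : AEStronglyMeasurable B ν :=
    (by fun_prop : AEMeasurable B ν).aestronglyMeasurable
  have hA0 : ∀ x, 0 ≤ A x := fun x => by positivity
  have hB0 : ∀ x, 0 ≤ B x := fun x => by positivity
  have hsum : ∫⁻ x, ENNReal.ofReal ((N : ℝ) ^ 2 / 4 * A x + 1 / 4 * B x) ∂ν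
      ≤ eLpNorm G 2 ν ^ 2 := by
    refine (lintegral_congr_ae ?_).trans_le key
    filter_upwards [huv, hlog] with x hx hx'
    rw [← hx]
    congr 1
    simp only [hA, hB, hardyWeight, sq_abs]
    have := hx'.1
    have : Real.log (Real.exp 1 / ‖x‖) ≠ 0 := by linarith [hx'.2]
    field_simp
    ring
  have hG2 : eLpNorm G 2 ν ^ 2 = ENNReal.ofReal (∫ x, ‖G x‖ ^ 2 ∂ν) := by
    rw [sq_eLpNorm_two, ofReal_integral_eq_lintegral_ofReal
      ((memLp_two_iff_integrable_sq_norm hu.memLp_grad.1).1 hu.memLp_grad)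
      (Eventually.of_forall fun x => by simp only [Pi.zero_apply]; positivity)]
    refine lintegral_congr fun x => ?_
    rw [ENNReal.ofReal_pow (norm_nonneg _), ofReal_norm]
  have hsumi : Integrable (fun x => (N : ℝ) ^ 2 / 4 * A x + 1 / 4 * B x) ν := by
    refine ⟨(hAm.const_mul _).add (hBm.const_mul _), ?_⟩
    rw [hasFiniteIntegral_iff_ofReal (Eventually.of_forall fun x => by
      have := hA0 x; have := hB0 x; simp only [Pi.zero_apply]; positivity)]
    refine hsum.trans_lt ?_
    rw [hG2]
    exact ENNReal.ofReal_lt_top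
  have hN4 : (1 : ℝ) ≤ (N : ℝ) ^ 2 / 4 := by
    have : (2 : ℝ) ≤ N := by exact_mod_cast hN
    nlinarith
  have hAi : Integrable A ν := hsumi.mono' hAm (Eventually.of_forall fun x => by
    rw [Real.norm_of_nonneg (hA0 x)]
    nlinarith [hA0 x, hB0 x])
  have hBi : Integrable B ν := (hsumi.const_mul 4).mono' hBm (Eventually.of_forall fun x => by
    rw [Real.norm_of_nonneg (hB0 x)]
    nlinarith [hA0 x, hB0 x])
  refine ⟨hAi, hBi, ?_⟩
  rw [← integral_const_mul, ← integral_const_mul, ← integral_add (hAi.const_mul _)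
    (hBi.const_mul _)]
  rw [hG2, ← ofReal_integral_eq_lintegral_ofReal hsumi (Eventually.of_forall fun x => by
      have := hA0 x; have := hB0 x; simp only [Pi.zero_apply]; positivity)] at hsum
  exact (ENNReal.ofReal_le_ofReal_iff (integral_nonneg fun x => by positivity)).1 hsum

/-- A test function is approximated by the constant sequence. -/
theorem IsTestFunction.isH10WithGradient {u : EuclideanSpace ℝ (Fin N) → ℝ}
    (hu : IsTestFunction u) : IsH10WithGradient u (gradient u) := by
  have hu1 : ContDiff ℝ 1 u := hu.smooth.of_le (by exact_mod_cast le_top)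
  have hgs : HasCompactSupport (gradient u) := by
    unfold gradient
    exact (hu.hasCompactSupport.fderiv ℝ).comp_left
      (g := (InnerProductSpace.toDual ℝ (EuclideanSpace ℝ (Fin N))).symm) (map_zero _)
  refine ⟨(hu1.continuous.memLp_of_hasCompactSupport hu.hasCompactSupport).restrict _,
    ((continuous_gradient hu1).memLp_of_hasCompactSupport hgs).restrict _,
    fun _ => u, fun _ => hu, ?_, ?_⟩ <;> simp

end EnergySpace

/-! ### Sharpness of the constant -/

theorem integral_inv_mul_comp_log {q : ℝ → ℝ} {ε : ℝ} (hε : 0 < ε) :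
    ∫ r in Set.Ioi (0 : ℝ), r⁻¹ * q (ε * Real.log r) = ε⁻¹ * ∫ t, q t := by
  have h := integral_image_eq_integral_abs_deriv_smul (s := Set.univ) (f := Real.exp)
    (f' := Real.exp) MeasurableSet.univ (fun x _ => (Real.hasDerivAt_exp x).hasDerivWithinAt)
    Real.exp_injective.injOn (fun r => r⁻¹ * q (ε * Real.log r))
  rw [Set.image_univ, Real.range_exp, Measure.restrict_univ] at h
  rw [h, ← smul_eq_mul, ← abs_of_pos (inv_pos.2 hε), ← Measure.integral_comp_mul_left q ε]
  congr 1; ext t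
  rw [Real.log_exp, abs_of_pos (Real.exp_pos t), smul_eq_mul,
    mul_inv_cancel_left₀ (Real.exp_ne_zero t)]

theorem integral_mul_add_mul_deriv_sq {η : ℝ → ℝ} (hη : ContDiff ℝ 1 η)
    (hη' : HasCompactSupport η) (s ε : ℝ) :
    ∫ t, (s * η t + ε * deriv η t) ^ 2
      = s ^ 2 * (∫ t, η t ^ 2) + ε ^ 2 * ∫ t, deriv η t ^ 2 := by
  have hc := hη.continuous
  have hc' : Continuous (deriv η) := hη.continuous_deriv le_rfl
  have hd' : HasCompactSupport (deriv η) := hη'.deriv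
  have i1 : Integrable fun t => η t ^ 2 := by
    simp only [sq]
    exact (hc.mul hc).integrable_of_hasCompactSupport hη'.mul_right
  have i2 : Integrable fun t => deriv η t ^ 2 := by
    simp only [sq]
    exact (hc'.mul hc').integrable_of_hasCompactSupport hd'.mul_right
  have i3 : Integrable fun t => η t * deriv η t :=
    (hc.mul hc').integrable_of_hasCompactSupport hη'.mul_right
  -- The cross term vanishes, because `η η'` is a derivative.
  have h0 : ∫ t, η t * deriv η t = 0 := by
    have hd : ∀ t, HasDerivAt η (deriv η t) t := fun t =>
      (hη.differentiable one_ne_zero t).hasDerivAt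
    have h := integral_mul_deriv_eq_deriv_mul_of_integrable (fun t _ => hd t) (fun t _ => hd t) i3
      (i3.congr (Eventually.of_forall fun t => mul_comm _ _))
      ((hc.mul hc).integrable_of_hasCompactSupport hη'.mul_right)
    simp only [mul_comm (deriv η _)] at h
    linarith
  have h : ∀ t, (s * η t + ε * deriv η t) ^ 2
      = s ^ 2 * η t ^ 2 + ε ^ 2 * deriv η t ^ 2 + 2 * s * ε * (η t * deriv η t) :=
    fun t => by ring
  have i12 : Integrable fun t => s ^ 2 * η t ^ 2 + ε ^ 2 * deriv η t ^ 2 :=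
    (i1.const_mul _).add (i2.const_mul _)
  simp only [h]
  rw [integral_add i12 (i3.const_mul _),
    integral_add (i1.const_mul _) (i2.const_mul _), integral_const_mul, integral_const_mul,
    integral_const_mul, h0, mul_zero, add_zero]

section Coordinates

variable {N : ℕ}

theorem gradient_coord (i : Fin N) (x : EuclideanSpace ℝ (Fin N)) :
    gradient (fun x : EuclideanSpace ℝ (Fin N) => x i) x = EuclideanSpace.single i 1 := by
  refine ext_inner_right ℝ fun v => ?_
  have h : HasFDerivAt (fun x : EuclideanSpace ℝ (Fin N) => x i)
      (EuclideanSpace.proj i : EuclideanSpace ℝ (Fin N) →L[ℝ] ℝ) x :=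
    (EuclideanSpace.proj i : EuclideanSpace ℝ (Fin N) →L[ℝ] ℝ).hasFDerivAt
  simp [gradient, h.fderiv, EuclideanSpace.inner_single_left]

theorem tangentialGradSq_coord (i : Fin N) (x : EuclideanSpace ℝ (Fin N)) :
    tangentialGradSq (fun x : EuclideanSpace ℝ (Fin N) => x i) x = 1 - x i ^ 2 := by
  simp [tangentialGradSq, gradient_coord, EuclideanSpace.inner_single_left]

/-- The coordinates have mean zero on the sphere, by the symmetry `x ↦ -x`. -/
theorem integral_sphere_coord [Nontrivial (EuclideanSpace ℝ (Fin N))] (i : Fin N) :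
    ∫ θ : sphere (0 : EuclideanSpace ℝ (Fin N)) 1, θ.1 i
      ∂(volume : Measure (EuclideanSpace ℝ (Fin N))).toSphere = 0 := by
  have h := integral_radial_mul_angular (volume : Measure (EuclideanSpace ℝ (Fin N)))
    (fun r => Real.exp (-(1 / 2) * r ^ 2)) (fun x => x i)
  have h2 := integral_neg_eq_self (fun x : EuclideanSpace ℝ (Fin N) =>
    Real.exp (-(1 / 2) * ‖x‖ ^ 2) * (‖x‖⁻¹ • x) i) volume
  have h3 : ∀ x : EuclideanSpace ℝ (Fin N),
      Real.exp (-(1 / 2) * ‖-x‖ ^ 2) * (‖-x‖⁻¹ • -x) i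
        = -(Real.exp (-(1 / 2) * ‖x‖ ^ 2) * (‖x‖⁻¹ • x) i) := by
    intro x; simp
  simp only [h3] at h2
  rw [integral_neg] at h2
  rw [show ∫ x : EuclideanSpace ℝ (Fin N), Real.exp (-(1 / 2) * ‖x‖ ^ 2) * (‖x‖⁻¹ • x) i = 0 by
    linarith] at h
  exact (mul_eq_zero.1 h.symm).resolve_left (gaussianMoment_pos _).ne'

theorem sum_integral_sphere_coord_sq [Nontrivial (EuclideanSpace ℝ (Fin N))] :
    ∑ i : Fin N, ∫ θ : sphere (0 : EuclideanSpace ℝ (Fin N)) 1, θ.1 i ^ 2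
        ∂(volume : Measure (EuclideanSpace ℝ (Fin N))).toSphere
      = (volume : Measure (EuclideanSpace ℝ (Fin N))).toSphere.real Set.univ := by
  rw [← integral_finsetSum _ fun i _ => ?_]
  · have h : ∀ θ : sphere (0 : EuclideanSpace ℝ (Fin N)) 1, ∑ i, θ.1 i ^ 2 = 1 := fun θ => by
      rw [← EuclideanSpace.real_norm_sq_eq, mem_sphere_zero_iff_norm.1 θ.2, one_pow]
    simp [h]
  · exact (by fun_prop : Continuous _).integrable_of_hasCompactSupport
      (HasCompactSupport.of_compactSpace _)

theorem sum_integral_sphere_tangentialGradSq_coord [Nontrivial (EuclideanSpace ℝ (Fin N))] :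
    ∑ i : Fin N, ∫ θ : sphere (0 : EuclideanSpace ℝ (Fin N)) 1,
        tangentialGradSq (fun x : EuclideanSpace ℝ (Fin N) => x i) θ.1
        ∂(volume : Measure (EuclideanSpace ℝ (Fin N))).toSphere
      = (N - 1) * (volume : Measure (EuclideanSpace ℝ (Fin N))).toSphere.real Set.univ := by
  have hi : ∀ i : Fin N, Integrable (fun θ : sphere (0 : EuclideanSpace ℝ (Fin N)) 1 => θ.1 i ^ 2)
      (volume : Measure (EuclideanSpace ℝ (Fin N))).toSphere := fun i =>
    (by fun_prop : Continuous _).integrable_of_hasCompactSupport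
      (HasCompactSupport.of_compactSpace _)
  simp only [tangentialGradSq_coord]
  simp_rw [integral_sub (integrable_const (1 : ℝ)) (hi _)]
  rw [Finset.sum_sub_distrib, sum_integral_sphere_coord_sq]
  simp
  ring

end Coordinates

section Sharpness

variable {N : ℕ}

/-- If `η` is supported in `(-∞, -1]`, then `η (ε log |x|)` vanishes for `|x| > e^(-1 / ε)`. -/
theorem isTestFunction_separated {s ε : ℝ} {η : ℝ → ℝ} {g : EuclideanSpace ℝ (Fin N) → ℝ}
    (hη : HasCompactSupport η) (hη' : ContDiff ℝ ∞ η) (hneg : ∀ t, -1 < t → η t = 0)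
    (hg : ContDiff ℝ ∞ g) (hε : 0 < ε) : IsTestFunction (separated s ε η g) := by
  have h0 : (0 : ℝ) ^ s * η 0 = 0 := by rw [hneg 0 (by norm_num), mul_zero]
  refine ⟨contDiff_separated (n := ⊤) hη hη' hg hε h0, hasCompactSupport_separated hη hε h0, ?_⟩
  have h1 : tsupport (separated s ε η g) ⊆ closedBall 0 (Real.exp (-1 / ε)) := by
    refine closure_minimal (fun x hx => ?_) isClosed_closedBall
    rcases eq_or_ne x 0 with rfl | hx0
    · exact mem_closedBall_self (Real.exp_pos _).le
    have hn : 0 < ‖x‖ := norm_pos_iff.2 hx0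
    rw [mem_closedBall_zero_iff, ← Real.log_le_iff_le_exp hn, le_div_iff₀ hε, mul_comm]
    by_contra hlt
    refine hx ?_
    rw [separated, hneg _ (not_le.1 hlt)]
    simp
  refine h1.trans (closedBall_subset_ball ?_)
  rw [Real.exp_lt_one_iff]
  exact div_neg_of_neg_of_pos (by norm_num) hε

theorem sphereIntegral_separated_coord [Nontrivial (EuclideanSpace ℝ (Fin N))] {s ε : ℝ}
    {η : ℝ → ℝ} (h0 : (0 : ℝ) ^ s * η 0 = 0) (i : Fin N) {r : ℝ} (hr : 0 ≤ r) :
    sphereIntegral (separated s ε η fun x : EuclideanSpace ℝ (Fin N) => x i) r = 0 := by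
  rcases hr.eq_or_lt with rfl | hr
  · simp [sphereIntegral, separated, h0]
  · simp only [sphereIntegral, separated, norm_smul_sphere hr, inv_smul_smul₀ hr.ne']
    rw [integral_const_mul, integral_sphere_coord, mul_zero]

/-- The sharpness of the constant: test with `x_i |x|^(-N / 2) η(ε log |x|)`, summed over `i`, and
let `ε → 0`. -/
theorem le_of_forall_hardy (hN : 2 ≤ N) {C : ℝ}
    (hC : ∀ u : EuclideanSpace ℝ (Fin N) → ℝ, IsTestFunction u →
      (∀ r : ℝ, 0 ≤ r → sphereIntegral u r = 0) →
      C * ∫ x in ball 0 1, |u x| ^ 2 / ‖x‖ ^ 2 ≤ ∫ x in ball 0 1, ‖gradient u x‖ ^ 2) :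
    C ≤ (N : ℝ) ^ 2 / 4 := by
  have := nontrivial_euclideanSpace_of_two_le hN
  -- `η` is supported in `[-3, -1]`, so that `η (ε log |x|)` lives on an annulus in the unit ball.
  let η : ContDiffBump (-2 : ℝ) := ⟨1 / 2, 1, by norm_num, by norm_num⟩
  have hηc : HasCompactSupport (η : ℝ → ℝ) := η.hasCompactSupport
  have hη1 : ContDiff ℝ 1 (η : ℝ → ℝ) := η.contDiff
  have hneg : ∀ t, -1 < t → (η : ℝ → ℝ) t = 0 := fun t ht => by
    refine η.zero_of_le_dist ?_
    rw [Real.dist_eq, abs_of_pos (by linarith)]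
    show (1 : ℝ) ≤ _
    linarith
  set s : ℝ := -((N : ℝ) - 2) / 2 with hs
  have h0 : (0 : ℝ) ^ s * (η : ℝ → ℝ) 0 = 0 := by rw [hneg 0 (by norm_num), mul_zero]
  set σ := (volume : Measure (EuclideanSpace ℝ (Fin N))).toSphere
  have hσ0 : 0 < σ.real Set.univ := toSphere_real_univ_pos (N := N)
  have hI : 0 < ∫ t, (η : ℝ → ℝ) t ^ 2 := by
    have hc : Continuous fun t => (η : ℝ → ℝ) t ^ 2 := hη1.continuous.pow 2
    refine hc.integral_pos_of_hasCompactSupport_nonneg_nonzero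
      (hηc.comp_left (g := fun t : ℝ => t ^ 2) (by simp)) (fun t => sq_nonneg _) (x := -2) ?_
    rw [η.one_of_mem_closedBall (by simp [η])]
    simp
  -- With `s = -(N - 2) / 2` the radial weight becomes `dr / r = d(log r)`.
  have hrpow : ∀ r : ℝ, 0 < r → r ^ (N - 1) * (r ^ (s - 1)) ^ 2 = r⁻¹ := fun r hr => by
    rw [← Real.rpow_natCast, ← Real.rpow_natCast (r ^ (s - 1)), ← Real.rpow_mul hr.le,
      ← Real.rpow_add hr, ← Real.rpow_neg_one]
    congr 1
    rw [Nat.cast_sub (by omega), hs]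
    push_cast
    ring
  have hrad : ∀ (ε : ℝ), 0 < ε → ∀ q : ℝ → ℝ, ∫ r in Set.Ioi (0 : ℝ),
      r ^ (N - 1) * (1 * (r ^ (s - 1) * q (ε * Real.log r)) ^ 2) = ε⁻¹ * ∫ t, q t ^ 2 := by
    intro ε hε q
    rw [← integral_inv_mul_comp_log hε]
    refine setIntegral_congr_fun measurableSet_Ioi fun r hr => ?_
    rw [← hrpow r hr]
    ring
  have main : ∀ ε : ℝ, 0 < ε → C * ∫ t, (η : ℝ → ℝ) t ^ 2
      ≤ (N : ℝ) ^ 2 / 4 * (∫ t, (η : ℝ → ℝ) t ^ 2) + ε ^ 2 * ∫ t, deriv η t ^ 2 := by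
    intro ε hε
    have hcoord : ∀ i : Fin N, ContDiff ℝ ∞ fun x : EuclideanSpace ℝ (Fin N) => x i :=
      fun i => by fun_prop
    have htest : ∀ i : Fin N, IsTestFunction
        (separated s ε η fun x : EuclideanSpace ℝ (Fin N) => x i) := fun i =>
      isTestFunction_separated hηc η.contDiff hneg (hcoord i) hε
    have hL : ∀ i : Fin N, ∫ x in ball 0 1,
        |separated s ε η (fun x : EuclideanSpace ℝ (Fin N) => x i) x| ^ 2 / ‖x‖ ^ 2
        = (ε⁻¹ * ∫ t, (η : ℝ → ℝ) t ^ 2)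
          * ∫ θ : sphere (0 : EuclideanSpace ℝ (Fin N)) 1, θ.1 i ^ 2 ∂σ := by
      intro i
      have h := integral_radial_mul_angular (volume : Measure (EuclideanSpace ℝ (Fin N)))
        (fun r => 1 * (r ^ (s - 1) * η (ε * Real.log r)) ^ 2) (fun x => x i ^ 2)
      rw [finrank_euclideanSpace_fin, hrad ε hε] at h
      rw [← h, setIntegral_eq_integral_of_forall_compl_eq_zero]
      · refine integral_congr_ae ?_
        filter_upwards [compl_mem_ae_iff.2
          (measure_singleton (0 : EuclideanSpace ℝ (Fin N)))] with x hx
        have hn : 0 < ‖x‖ := norm_pos_iff.2 hx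
        simp only [separated, sq_abs]
        rw [Real.rpow_sub_one hn.ne']
        field_simp
      · intro x hx
        rw [image_eq_zero_of_notMem_tsupport fun h => hx ((htest i).tsupport_subset h)]
        simp
    have hR : ∀ i : Fin N, ∫ x in ball 0 1,
        ‖gradient (separated s ε η (fun x : EuclideanSpace ℝ (Fin N) => x i)) x‖ ^ 2
        = (ε⁻¹ * ∫ t, (η : ℝ → ℝ) t ^ 2)
          * (∫ θ : sphere (0 : EuclideanSpace ℝ (Fin N)) 1,
            tangentialGradSq (fun x : EuclideanSpace ℝ (Fin N) => x i) θ.1 ∂σ)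
        + (ε⁻¹ * ∫ t, (s * η t + ε * deriv η t) ^ 2)
          * ∫ θ : sphere (0 : EuclideanSpace ℝ (Fin N)) 1, θ.1 i ^ 2 ∂σ := by
      intro i
      have h := integral_norm_gradient_separated_sq (E := EuclideanSpace ℝ (Fin N)) (s := s)
        (w := fun _ => 1) continuousOn_const hηc hη1 ((hcoord i).of_le (by exact_mod_cast le_top))
        hε
      rw [finrank_euclideanSpace_fin, hrad ε hε η,
        hrad ε hε fun t => s * η t + ε * deriv η t] at h
      rw [← h, setIntegral_eq_integral_of_forall_compl_eq_zero]
      · simp only [one_mul]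
      · intro x hx
        have : fderiv ℝ (separated s ε η (fun x : EuclideanSpace ℝ (Fin N) => x i)) x = 0 :=
          image_eq_zero_of_notMem_tsupport fun h => hx ((htest i).tsupport_subset
            (tsupport_fderiv_subset ℝ h))
        simp [gradient, this]
    -- Summing over the coordinates, only `∑ θ_i² = 1` is needed on the sphere.
    have hsum := Finset.sum_le_sum fun i (_ : i ∈ Finset.univ) =>
      hC _ (htest i) fun r hr => sphereIntegral_separated_coord h0 i hr
    simp only [hL, hR] at hsum
    rw [Finset.sum_add_distrib, ← Finset.mul_sum, ← Finset.mul_sum, ← Finset.mul_sum,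
      ← Finset.mul_sum, sum_integral_sphere_coord_sq, sum_integral_sphere_tangentialGradSq_coord,
      integral_mul_add_mul_deriv_sq hη1 hηc] at hsum
    have hpos : 0 < ε⁻¹ * σ.real Set.univ := by positivity
    refine le_of_mul_le_mul_left ?_ hpos
    have hs2 : s ^ 2 + (N - 1) = (N : ℝ) ^ 2 / 4 := by rw [hs]; ring
    rw [← hs2]
    linarith
  have hlim : Tendsto (fun n : ℕ => (N : ℝ) ^ 2 / 4 * (∫ t, (η : ℝ → ℝ) t ^ 2)
      + (1 / ((n : ℝ) + 1)) ^ 2 * ∫ t, deriv η t ^ 2) atTop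
      (𝓝 ((N : ℝ) ^ 2 / 4 * (∫ t, (η : ℝ → ℝ) t ^ 2))) := by
    have := ((tendsto_one_div_add_atTop_nhds_zero_nat (𝕜 := ℝ)).pow 2).mul_const
      (∫ t, deriv η t ^ 2)
    simpa using this.const_add ((N : ℝ) ^ 2 / 4 * (∫ t, (η : ℝ → ℝ) t ^ 2))
  exact le_of_mul_le_mul_right
    (ge_of_tendsto' hlim fun n => main _ (by positivity)) hI

end Sharpness

theorem mainTheorem7 :
    (∀ N : ℕ, 2 ≤ N →
      -- the Hardy inequality under spherical average zero
      (∀ u : EuclideanSpace ℝ (Fin N) → ℝ, IsTestFunction u →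
        (∀ r : ℝ, 0 ≤ r → sphereIntegral u r = 0) →
        IntegrableOn (fun x => |u x| ^ 2 / ‖x‖ ^ 2) (ball 0 1) ∧
        (N : ℝ) ^ 2 / 4 * ∫ x in ball 0 1, |u x| ^ 2 / ‖x‖ ^ 2
          ≤ ∫ x in ball 0 1, ‖gradient u x‖ ^ 2) ∧
      -- the constant is the best one
      (∀ C : ℝ,
        (∀ u : EuclideanSpace ℝ (Fin N) → ℝ, IsTestFunction u →
          (∀ r : ℝ, 0 ≤ r → sphereIntegral u r = 0) →
          C * ∫ x in ball 0 1, |u x| ^ 2 / ‖x‖ ^ 2 ≤ ∫ x in ball 0 1, ‖gradient u x‖ ^ 2) →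
        C ≤ (N : ℝ) ^ 2 / 4) ∧
      -- the constant is not attained, not even in the energy space
      (¬ ∃ (u : EuclideanSpace ℝ (Fin N) → ℝ)
          (G : EuclideanSpace ℝ (Fin N) → EuclideanSpace ℝ (Fin N)),
        IsH10WithGradient u G ∧
        (∀ᵐ r ∂(volume.restrict (Set.Ioo (0 : ℝ) 1)), sphereIntegral u r = 0) ∧
        ¬ (u =ᵐ[volume.restrict (ball 0 1)] 0) ∧
        (N : ℝ) ^ 2 / 4 * ∫ x in ball 0 1, |u x| ^ 2 / ‖x‖ ^ 2
          = ∫ x in ball 0 1, ‖G x‖ ^ 2)) ∧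
    -- the critical Hardy inequality under spherical average zero in dimension two
    (∀ u : EuclideanSpace ℝ (Fin 2) → ℝ, IsTestFunction u →
      (∀ r : ℝ, 0 ≤ r → sphereIntegral u r = 0) →
      IntegrableOn (fun x => |u x| ^ 2 / (‖x‖ ^ 2 * Real.log (Real.exp 1 / ‖x‖) ^ 2)) (ball 0 1) ∧
      5 / 4 * ∫ x in ball 0 1, |u x| ^ 2 / (‖x‖ ^ 2 * Real.log (Real.exp 1 / ‖x‖) ^ 2)
        ≤ ∫ x in ball 0 1, ‖gradient u x‖ ^ 2) := by
  have hae : ∀ {N : ℕ} {u : EuclideanSpace ℝ (Fin N) → ℝ},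
      (∀ r : ℝ, 0 ≤ r → sphereIntegral u r = 0) →
      ∀ᵐ r ∂(volume.restrict (Set.Ioo (0 : ℝ) 1)), sphereIntegral u r = 0 := fun h =>
    (ae_restrict_iff' measurableSet_Ioo).2 (Eventually.of_forall fun r hr => h r hr.1.le)
  have hnn : ∀ {N : ℕ} (u : EuclideanSpace ℝ (Fin N) → ℝ), 0 ≤ ∫ x in ball 0 1,
      |u x| ^ 2 / (‖x‖ ^ 2 * Real.log (Real.exp 1 / ‖x‖) ^ 2) := fun u =>
    integral_nonneg fun x => by positivity
  refine ⟨fun N hN => ⟨fun u hu hmean => ?_, fun C hC => le_of_forall_hardy hN hC, ?_⟩,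
    fun u hu hmean => ?_⟩
  · obtain ⟨h1, -, h3⟩ := integral_hardy_le hN hu.isH10WithGradient (hae hmean)
    exact ⟨h1, by linarith [hnn u]⟩
  · -- Equality forces the logarithmic remainder term, hence `u`, to vanish.
    rintro ⟨u, G, hu, hmean, hu0, heq⟩
    have := nontrivial_euclideanSpace_of_two_le hN
    obtain ⟨-, h2, h3⟩ := integral_hardy_le hN hu hmean
    have hzero := le_antisymm (by linarith) (hnn u)
    rw [integral_eq_zero_iff_of_nonneg (fun x => by positivity) h2] at hzero
    refine hu0 ?_
    filter_upwards [hzero, ae_restrict_mem measurableSet_ball,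
      ae_restrict_of_ae (compl_mem_ae_iff.2 (measure_singleton 0))] with x hx hxb hx0
    have hn : 0 < ‖x‖ := norm_pos_iff.2 hx0
    have hl := one_le_log_exp_div hn (mem_ball_zero_iff.1 hxb).le
    have hd : ‖x‖ ^ 2 * Real.log (Real.exp 1 / ‖x‖) ^ 2 ≠ 0 := by positivity
    simpa using (div_eq_zero_iff.1 hx).resolve_right hd
  · obtain ⟨h1, h2, h3⟩ := integral_hardy_le le_rfl hu.isH10WithGradient (hae hmean)
    refine ⟨h2, ?_⟩
    have hle := setIntegral_mono_on h2 h1 measurableSet_ball fun x hx => by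
      rcases eq_or_ne x 0 with rfl | hx0
      · simp
      have hn : 0 < ‖x‖ := norm_pos_iff.2 hx0
      have hl := one_le_log_exp_div hn (mem_ball_zero_iff.1 hx).le
      gcongr
      exact le_mul_of_one_le_right (by positivity) (one_le_pow₀ hl)
    rw [show ((2 : ℕ) : ℝ) ^ 2 / 4 = 1 by norm_num] at h3
    linarith
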